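/- **Model.** Base stations (BSs) form a homogeneous Poisson point process $\Phi_{BS}$ of intensity $\lambda_{BS}>0$ in $\mathbb{R}^2$; users have density $\lambda_{UE}>0$; the typical user is at the origin. Fix integers $N_{BS},N_{UE},U_M\ge 1$, reals $P,\lambda_c,D,\alpha_L,\alpha_N,\xi_L,\xi_N>0$, $p_{LOS}\in[0,1]$, and real sidelobe parameters $\rho_{BS},\rho_{UE}$. The link from a BS at $y$ is line-of-sight (L) with probability $p_{LOS}$ if $\|y\|\le D$, independently of everything else, and otherwise non-line-of-sight (N). Its path loss in dB is $\beta+10\alpha_j\log_{10}\|y\|+S_y$ with $\beta=20\log_{10}(4\pi/\lambda_c)$, $S_y\sim N(0,\xi_j^2)$, $j\in\{L,N\}$ the type of the link; $L(y,0)$ denotes the path loss in linear scale. The typical user is served by the BS $x$ of minimum path loss. For an array with $N$ antennas let $$q_{i}=\tfrac1\pi\Big(\arcsin\big(-1+\tfrac{2i+1}{N}\big)-\arcsin\big(-1+\tfrac{2i-1}{N}\big)\Big)\ (1\le i\le N-1),\qquad q_{N}=1-\sum_{i<N}q_{i},$$ written $q_{BS,i}$ for $N=N_{BS}$ and $q_{UE,i}$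 for $N=N_{UE}$. With $r=\lambda_{UE}/\lambda_{BS}$ let $$\kappa(n)=\frac{3.5^{3.5}}{n!}\frac{\Gamma(n+3.5)}{\Gamma(3.5)}r^n(3.5+r)^{-n-3.5}\quad(n\ge0),$$ and let $\tilde p(n)=\kappa(n)$ for $0\le n<U_M$, $\tilde p(U_M)=1-\sum_{i=0}^{U_M-1}\kappa(i)$. Put $G=PN_{BS}N_{UE}$, $a=\sum_{i=1}^{N_{UE}}q_{UE,i}^2$, $v_{n,k}=k+(n-k)\rho_{BS}^2$. The out-of-cell interference for single-path channels is $$I_0=\sum_{y\in\Phi_{BS},\,y\ne x}\frac{G|\gamma_y|^2\chi_y}{L(y,0)\,U_y}\in[0,\infty],$$ where terms with $U_y=0$ are $0$, the $\gamma_y$ are standard complex normal, $U_y$ has distribution $\tilde p$ and, given $U_y=n$, $\chi_y$ takes the value $v_{n,k}$ with probability $a\binom nk\sum_{j=1}^{N_{BS}}q_{BS,j}^{k+1}(1-q_{BS,j})^{n-k}$ and the value $\rho_{UE}^2v_{n,k}$ with probability $(1-a)\binom nk\sum_{j=1}^{N_{BS}}q_{BS,j}^{k+1}(1-q_{BS,j})^{n-k}$,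 $k=0,\dots,n$. The pairs $(U_y,\chi_y)$, the $\gamma_y$, the link types and the normalized shadowings are mutually independent, independent between BSs, and independent of the positions. With $m=-0.1\,\beta\ln10$, $\sigma_j=0.1\,\xi_j\ln10$, $\Upsilon_j(t)=(\ln(D^{\alpha_j}/t)-m)/\sigma_j$ and $Q$ the standard Gaussian tail function, let $M=M_L+M_N$, $$M_L(t)=\pi p_{LOS}\Big[D^2Q(\Upsilon_L(t))+t^{2/\alpha_L}e^{2\sigma_L^2/\alpha_L^2+2m/\alpha_L}\,Q\big(\tfrac{2\sigma_L}{\alpha_L}-\Upsilon_L(t)\big)\Big],$$ $$M_N(t)=-\pi p_{LOS}D^2Q(\Upsilon_N(t))+\pi t^{2/\alpha_N}e^{2\sigma_N^2/\alpha_N^2+2m/\alpha_N}\Big[1-p_{LOS}\,Q\big(\tfrac{2\sigma_N}{\alpha_N}-\Upsilon_N(t)\big)\Big].$$ **Lemma.** $M$ is differentiable on $(0,\infty)$ with $M'\ge0$. For every $s\ge0$ and almost every $l$ with respect to the law of $L(x,0)$ (which is carried by $(0,\infty)$), $$\mathbb{E}\big[e^{-sI_0}\,\big|\,L(x,0)=l\big]=\exp\Bigg(-\lambda_{BS}\sum_{n=0}^{U_M}\tilde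 p(n)\sum_{k=0}^n\binom nk\sum_{i=1}^{N_{BS}}q_{BS,i}^{k+1}(1-q_{BS,i})^{n-k}\Big\{a\int_l^\infty\frac{M'(t)\,dt}{1+\frac{tn}{sGv_{n,k}}}+(1-a)\int_l^\infty\frac{M'(t)\,dt}{1+\frac{tn}{sG\rho_{UE}^2v_{n,k}}}\Big\}\Bigg),$$ where an integrand is read as $0$ when the inner denominator ($sGv_{n,k}$, respectively $sG\rho_{UE}^2v_{n,k}$) is $0$ (in particular for $n=0$), and $e^{-\infty}=0$, $0\cdot\infty=0$. If $\alpha_N>2$, then $I_0<\infty$ almost surely and all the integrals with nonzero coefficient, hence the exponent, are finite for every $l>0$. -/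

import Mathlib

open MeasureTheory ProbabilityTheory
open scoped ENNReal NNReal

noncomputable section

namespace MmWave

/-- Parameters of the downlink millimetre-wave network. -/
structure Params where
  /-- density of base stations (BSs) -/
  lamBS : ℝ
  /-- density of users (UEs) -/
  lamUE : ℝ
  /-- number of BS antennas -/
  NBS : ℕ
  /-- number of UE antennas -/
  NUE : ℕ
  /-- maximum number of users served by a BS in one time slot -/
  UM : ℕ
  /-- transmit power -/
  power : ℝ
  /-- carrier wavelength -/
  wavelength : ℝ
  /-- line-of-sight (LOS) radius -/
  D : ℝ
  /-- probability that a link of length at most `D` is LOS -/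
  pLOS : unitInterval
  /-- LOS path loss exponent -/
  alphaL : ℝ
  /-- non-line-of-sight (NLOS) path loss exponent -/
  alphaN : ℝ
  /-- LOS shadowing standard deviation in dB -/
  xiL : ℝ
  /-- NLOS shadowing standard deviation in dB -/
  xiN : ℝ
  /-- inner product of two distinct BS beam steering vectors -/
  rhoBS : ℝ
  /-- inner product of two distinct UE beam steering vectors -/
  rhoUE : ℝ
  lamBS_pos : 0 < lamBS
  lamUE_pos : 0 < lamUE
  NBS_pos : 1 ≤ NBS
  NUE_pos : 1 ≤ NUE
  UM_pos : 1 ≤ UM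
  power_pos : 0 < power
  wavelength_pos : 0 < wavelength
  D_pos : 0 < D
  alphaL_pos : 0 < alphaL
  alphaN_pos : 0 < alphaN
  xiL_pos : 0 < xiL
  xiN_pos : 0 < xiN

/-- Probability that a quantized virtual angle takes its `i`-th value, `1 ≤ i ≤ N`, for an array
of `N` antennas. -/
def angleProb (N i : ℕ) : ℝ :=
  let q : ℕ → ℝ := fun i =>
    (Real.arcsin (-1 + (2 * i + 1) / N) - Real.arcsin (-1 + (2 * i - 1) / N)) / Real.pi
  if i < N then q i else 1 - ∑ j ∈ Finset.Ico 1 N, q j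

namespace Params

variable (p : Params)

/-- `G = P N_BS N_UE`. -/
def G : ℝ := p.power * p.NBS * p.NUE

/-- Reference path loss at one metre, in dB. -/
def beta : ℝ := 20 * Real.logb 10 (4 * Real.pi / p.wavelength)

/-! ### The load and the beam gain of an interfering BS -/

/-- Probability that `n` users are connected to an interfering BS. -/
def kappa (n : ℕ) : ℝ :=
  (3.5 : ℝ) ^ (3.5 : ℝ) / (n.factorial : ℝ) * (Real.Gamma (n + 3.5) / Real.Gamma 3.5)
    * (p.lamUE / p.lamBS) ^ n * (3.5 + p.lamUE / p.lamBS) ^ (-(n : ℝ) - 3.5)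

/-- Distribution of the number `min (UM, N)` of users scheduled by an interfering BS, where `N`
has probability mass function `kappa`. -/
def loadPMF (n : ℕ) : ℝ :=
  if n < p.UM then p.kappa n
  else if n = p.UM then 1 - ∑ i ∈ Finset.range p.UM, p.kappa i
  else 0

/-- Probability that two independent virtual angles at UEs coincide. -/
def alignProb : ℝ := ∑ i ∈ Finset.Icc 1 p.NUE, angleProb p.NUE i ^ 2

/-- Probability that exactly `k` of `n` independent BS virtual angles coincide with a further
independent one. -/
def collisionProb (n k : ℕ) : ℝ :=
  (n.choose k : ℝ) * ∑ i ∈ Finset.Icc 1 p.NBS,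
    angleProb p.NBS i ^ (k + 1) * (1 - angleProb p.NBS i) ^ (n - k)

/-- Beam gain `k + (n - k) ρ_BS²`. -/
def beamGain (n k : ℕ) : ℝ := k + ((n : ℝ) - k) * p.rhoBS ^ 2

/-- Joint law of `(U_y, χ_y)`: `U_y` has distribution `loadPMF` and, given `U_y = n`, `χ_y` is
`beamGain n k` with probability `alignProb * collisionProb n k` and `ρ_UE² * beamGain n k` with
probability `(1 - alignProb) * collisionProb n k`, for `k = 0, …, n`. -/
def loadGainLaw : Measure (ℕ × ℝ) :=
  ∑ n ∈ Finset.range (p.UM + 1), ∑ k ∈ Finset.range (n + 1),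
    (ENNReal.ofReal (p.loadPMF n * (p.alignProb * p.collisionProb n k)) •
        Measure.dirac (n, p.beamGain n k) +
      ENNReal.ofReal (p.loadPMF n * ((1 - p.alignProb) * p.collisionProb n k)) •
        Measure.dirac (n, p.rhoUE ^ 2 * p.beamGain n k))

end Params

/-! ### The network -/

/-- The plane with its Euclidean norm. -/
abbrev Plane : Type := EuclideanSpace ℝ (Fin 2)

/-- Number of indices `i` with `Y i ω ∈ A` (for measurable `A`). -/
def count {Ω E : Type*} [MeasurableSpace E] (Y : ℕ → Ω → E) (A : Set E) (ω : Ω) : ℝ≥0∞ :=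
  (Measure.sum fun i => Measure.dirac (Y i ω)) A

/-- The random points `Y 0, Y 1, …` form a Poisson point process with intensity measure `μ`. -/
structure IsPoissonProcess {Ω E : Type*} [MeasurableSpace Ω] [MeasurableSpace E]
    (Y : ℕ → Ω → E) (μ : Measure E) (P : Measure Ω) : Prop where
  law : ∀ A : Set E, MeasurableSet A → μ A < ∞ →
    P.map (count Y A) = (poissonMeasure (μ A).toNNReal).map (fun n : ℕ => (n : ℝ≥0∞))
  indep : ∀ (n : ℕ) (A : Fin n → Set E), (∀ j, MeasurableSet (A j)) →
    Pairwise (fun i j => Disjoint (A i) (A j)) → iIndepFun (fun j => count Y (A j)) P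

/-- Law of a complex normal variable with zero mean and unit variance. -/
def stdComplexNormal : Measure ℂ :=
  ((gaussianReal 0 (1 / 2)).prod (gaussianReal 0 (1 / 2))).map (fun z => (⟨z.1, z.2⟩ : ℂ))

/-- Random quantities attached to a BS. -/
structure Mark where
  /-- whether the link to the typical user is LOS if its length is at most `D` -/
  clear : Bool
  /-- shadowing in dB, divided by its standard deviation -/
  shadow : ℝ
  /-- small scale fading -/
  fading : ℂ
  /-- number of users scheduled, if the BS is an interferer -/
  load : ℕ
  /-- total beam gain towards the typical user, if the BS is an interferer -/
  gain : ℝ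

/-- A mark as a tuple. -/
def Mark.toTuple (m : Mark) : Bool × ℝ × ℂ × (ℕ × ℝ) :=
  (m.clear, m.shadow, m.fading, (m.load, m.gain))

instance : MeasurableSpace Mark := MeasurableSpace.comap Mark.toTuple inferInstance

namespace Params

variable (p : Params)

/-- Law of the tuple of marks of a BS: the LOS indicator, the shadowing, the fading and the pair
(load, gain) are independent. -/
def markLaw : Measure (Bool × ℝ × ℂ × (ℕ × ℝ)) :=
  (bernoulliMeasure true false p.pLOS).prod
    ((gaussianReal 0 1).prod (stdComplexNormal.prod p.loadGainLaw))

/-- Path loss in dB from a BS at `y` to the user at the origin: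
`β + 10 α log₁₀ ‖y‖ + S`, with `α` and the standard deviation of `S` depending on whether the link
is LOS or NLOS. -/
def lossDB (y : Plane) (m : Mark) : ℝ :=
  if ‖y‖ ≤ p.D ∧ m.clear = true then
    p.beta + 10 * p.alphaL * Real.logb 10 ‖y‖ + p.xiL * m.shadow
  else
    p.beta + 10 * p.alphaN * Real.logb 10 ‖y‖ + p.xiN * m.shadow

/-- Path loss in linear scale. -/
def loss (y : Plane) (m : Mark) : ℝ := (10 : ℝ) ^ (p.lossDB y m / 10)

end Params

/-- The network seen from the typical user at the origin, for single-path channels: a Poisson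
process of BSs with independent and identically distributed marks which are independent of the
positions, and the BS of minimum path loss, which serves the typical user. -/
structure Network {Ω : Type*} [MeasurableSpace Ω] (p : Params) (P : Measure Ω) where
  /-- position of a BS -/
  pos : ℕ → Ω → Plane
  /-- marks of a BS -/
  mark : ℕ → Ω → Mark
  /-- index of the serving BS -/
  serving : Ω → ℕ
  measurable_pos : ∀ i, Measurable (pos i)
  measurable_mark : ∀ i, Measurable (mark i)
  measurable_serving : Measurable serving
  isPoisson : IsPoissonProcess pos (ENNReal.ofReal p.lamBS • volume) P
  mark_law : ∀ i, P.map (fun ω => (mark i ω).toTuple) = p.markLaw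
  mark_indep : iIndepFun mark P
  mark_indep_pos : IndepFun (fun ω i => mark i ω) (fun ω i => pos i ω) P
  serving_min : ∀ᵐ ω ∂P, ∀ i,
    p.loss (pos (serving ω) ω) (mark (serving ω) ω) ≤ p.loss (pos i ω) (mark i ω)

/-- `exp (-x)` for `x ∈ [0, ∞]`, with `exp (-∞) = 0`. -/
def expNeg (x : ℝ≥0∞) : ℝ := if x = ∞ then 0 else Real.exp (-x.toReal)

namespace Network

variable {Ω : Type*} [MeasurableSpace Ω] {p : Params} {P : Measure Ω} (net : Network p P)

/-- Path loss between BS number `i` and the typical user. -/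
def lossOf (i : ℕ) (ω : Ω) : ℝ := p.loss (net.pos i ω) (net.mark i ω)

/-- Path loss of the serving link. -/
def servingLoss (ω : Ω) : ℝ := net.lossOf (net.serving ω) ω

/-- Out-of-cell interference power at the typical user,
`∑_{y ≠ x} G |γ_y|² L(y,0)⁻¹ χ_y / U_y`; a BS with `U_y = 0` contributes `0`. -/
def interference (ω : Ω) : ℝ≥0∞ :=
  ∑' i, if i = net.serving ω then 0 else
    ENNReal.ofReal (p.G * ‖(net.mark i ω).fading‖ ^ 2 * (net.lossOf i ω)⁻¹ *
      (net.mark i ω).gain / (net.mark i ω).load)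

/-- Laplace transform at `s` of the interference, conditioned on the path loss `l` of the serving
link: `E[exp (-s I) | L(x,0) = l]`. -/
def condLaplace [IsFiniteMeasure P] (s l : ℝ) : ℝ :=
  ∫ I, expNeg (ENNReal.ofReal s * I) ∂(condDistrib net.interference net.servingLoss P l)

end Network

/-! ### The closed form -/

/-- Complementary distribution function of the standard normal law. -/
def Q (x : ℝ) : ℝ := (gaussianReal 0 1).real (Set.Ioi x)

namespace Params

variable (p : Params)

/-- `m = -0.1 β ln 10`. -/
def m : ℝ := -0.1 * p.beta * Real.log 10

/-- `σ_L = 0.1 ξ_L ln 10`. -/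
def sigmaL : ℝ := 0.1 * p.xiL * Real.log 10

/-- `σ_N = 0.1 ξ_N ln 10`. -/
def sigmaN : ℝ := 0.1 * p.xiN * Real.log 10

/-- `Υ_L(t)`. -/
def upsL (t : ℝ) : ℝ := (Real.log (p.D ^ p.alphaL / t) - p.m) / p.sigmaL

/-- `Υ_N(t)`. -/
def upsN (t : ℝ) : ℝ := (Real.log (p.D ^ p.alphaN / t) - p.m) / p.sigmaN

/-- `M_L(t)`: for a unit density of BSs, the mean number of LOS links of loss less than `t`. -/
def ML (t : ℝ) : ℝ :=
  Real.pi * p.pLOS * (p.D ^ 2 * Q (p.upsL t) +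
    t ^ (2 / p.alphaL) * Real.exp (2 * p.sigmaL ^ 2 / p.alphaL ^ 2 + 2 * p.m / p.alphaL) *
      Q (2 * p.sigmaL ^ 2 / (p.alphaL * p.sigmaL) - p.upsL t))

/-- `M_N(t)`: for a unit density of BSs, the mean number of NLOS links of loss less than `t`. -/
def MN (t : ℝ) : ℝ :=
  -Real.pi * p.pLOS * p.D ^ 2 * Q (p.upsN t) +
    Real.pi * t ^ (2 / p.alphaN) *
      Real.exp (2 * p.sigmaN ^ 2 / p.alphaN ^ 2 + 2 * p.m / p.alphaN) *
      (1 - p.pLOS * Q (2 * p.sigmaN ^ 2 / (p.alphaN * p.sigmaN) - p.upsN t))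

/-- `M = M_L + M_N`. -/
def M (t : ℝ) : ℝ := p.ML t + p.MN t

/-- The fraction `1 / (1 + t n / (s G v))`, read as `0` if `s G v = 0`. -/
def kernel (s v : ℝ) (n : ℕ) (t : ℝ) : ℝ :=
  if s * p.G * v = 0 then 0 else 1 / (1 + t * n / (s * p.G * v))

/-- `∫_{t ≥ l} M'(t) dt / (1 + t n / (s G v))`, with values in `[0, ∞]`. -/
def lossIntegral (s l v : ℝ) (n : ℕ) : ℝ≥0∞ :=
  ∫⁻ t in Set.Ici l, ENNReal.ofReal (deriv p.M t * p.kernel s v n t)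

/-- The double sum over loads `n` and collision counts `k` in the exponent of the closed form. -/
def exponent (s l : ℝ) : ℝ≥0∞ :=
  ∑ n ∈ Finset.range (p.UM + 1), ENNReal.ofReal (p.loadPMF n) *
    ∑ k ∈ Finset.range (n + 1), ENNReal.ofReal (p.collisionProb n k) *
      (ENNReal.ofReal p.alignProb * p.lossIntegral s l (p.beamGain n k) n +
        ENNReal.ofReal (1 - p.alignProb) *
          p.lossIntegral s l (p.rhoUE ^ 2 * p.beamGain n k) n)

end Params

end MmWave

end

/-!
Together with the LOS indicators, the shadowings, the fading and the loads as marks, the BSs form a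
Poisson process, and so do the pairs (path loss, interference) computed from them. Both facts are
read off the Laplace functional. The first coordinates have the intensity `λ_BS dM`, because `M t`
is the area of the positions of path loss at most `t`, averaged over the link type and the shadowing
(a Gaussian integral).

Restrictions of a Poisson process to disjoint sets are independent, so given that the minimum path
loss is `l`, the other pairs form the Poisson process above `l`. The conditional Laplace transform
of the interference is therefore the exponential of `-∫ (1 - e^{-s I})` over the pairs with loss
above `l`, and averaging over the fading `|γ|²`, an exponential variable, yields the factor
`1 / (1 + t n / (s G v))`.

If `α_N > 2`, then `M t = O(1 + t ^ (2 / α_N))`, whence `∫_l^∞ t⁻¹ dM(t) < ∞`. This bounds the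
exponent, which then tends to `0` with `s`; hence `I_0 < ∞` almost surely.
-/

noncomputable section

namespace MmWave

open Filter Topology Set

/-! ### Laplace transforms with values in `[0, ∞]` -/

/-- `exp (-x)` for `x ∈ [0, ∞]`, as an element of `[0, ∞]`: in contrast to `expNeg`, it can be
integrated without integrability conditions. -/
def nexp (x : ℝ≥0∞) : ℝ≥0∞ := EReal.exp (-(x : EReal))

@[simp] lemma nexp_zero : nexp 0 = 1 := by simp [nexp]

@[simp] lemma nexp_top : nexp ∞ = 0 := by simp [nexp]

lemma nexp_ofReal {x : ℝ} (hx : 0 ≤ x) :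
    nexp (ENNReal.ofReal x) = ENNReal.ofReal (Real.exp (-x)) := by
  rw [nexp, EReal.coe_ennreal_ofReal, max_eq_left hx, ← EReal.coe_neg, EReal.exp_coe]

lemma nexp_add (x y : ℝ≥0∞) : nexp (x + y) = nexp x * nexp y := by
  rw [nexp, EReal.coe_ennreal_add, EReal.neg_add (by simp) (by simp), sub_eq_add_neg,
    EReal.exp_add]
  rfl

lemma nexp_sum {ι : Type*} (s : Finset ι) (f : ι → ℝ≥0∞) :
    nexp (∑ i ∈ s, f i) = ∏ i ∈ s, nexp (f i) := by
  classical
  induction s using Finset.induction_on with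
  | empty => simp
  | insert a s ha ih => rw [Finset.sum_insert ha, Finset.prod_insert ha, nexp_add, ih]

lemma nexp_mul_natCast (x : ℝ≥0∞) (n : ℕ) : nexp (x * n) = nexp x ^ n := by
  simpa [mul_comm] using nexp_sum (Finset.range n) fun _ => x

lemma continuous_nexp : Continuous nexp :=
  ENNReal.continuous_exp.comp (continuous_neg.comp continuous_coe_ennreal_ereal)

@[fun_prop] lemma measurable_nexp : Measurable nexp := continuous_nexp.measurable

lemma antitone_nexp : Antitone nexp := fun _ _ h =>
  EReal.exp_monotone (EReal.neg_le_neg_iff.2 (EReal.coe_ennreal_le_coe_ennreal_iff.2 h))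

lemma nexp_le_one (x : ℝ≥0∞) : nexp x ≤ 1 := by
  simpa using antitone_nexp (zero_le (a := x))

lemma nexp_ne_top (x : ℝ≥0∞) : nexp x ≠ ∞ := ((nexp_le_one x).trans_lt ENNReal.one_lt_top).ne

lemma expNeg_nonneg (x : ℝ≥0∞) : 0 ≤ expNeg x := by
  unfold expNeg
  split_ifs <;> positivity

lemma toReal_nexp (x : ℝ≥0∞) : (nexp x).toReal = expNeg x := by
  induction x with
  | top => simp [expNeg]
  | coe x =>
    rw [expNeg, if_neg ENNReal.coe_ne_top, ENNReal.coe_toReal, ← ENNReal.ofReal_coe_nnreal,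
      nexp_ofReal x.coe_nonneg, ENNReal.toReal_ofReal (Real.exp_pos _).le]

lemma ofReal_expNeg (x : ℝ≥0∞) : ENNReal.ofReal (expNeg x) = nexp x := by
  rw [← toReal_nexp, ENNReal.ofReal_toReal (nexp_ne_top x)]

/-- The inverse of `nexp` on `[0, 1]`. -/
def nlog (g : ℝ≥0∞) : ℝ≥0∞ := (-ENNReal.log g).toENNReal

lemma nexp_nlog {g : ℝ≥0∞} (hg : g ≤ 1) : nexp (nlog g) = g := by
  have : 0 ≤ -ENNReal.log g := by
    rw [EReal.neg_nonneg, ← ENNReal.log_one]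
    exact ENNReal.log_monotone hg
  rw [nexp, nlog, EReal.coe_toENNReal this, neg_neg, ENNReal.exp_log]

@[fun_prop] lemma measurable_nlog : Measurable nlog :=
  EReal.continuous_toENNReal.measurable.comp
    (continuous_neg.measurable.comp ENNReal.continuous_log.measurable)

attribute [irreducible] nexp

lemma tendsto_lintegral_nexp_sum {Ω : Type*} [MeasurableSpace Ω] {P : Measure Ω}
    [IsFiniteMeasure P] {u : ℕ → Ω → ℝ≥0∞} (hu : ∀ i, Measurable (u i)) :
    Tendsto (fun n => ∫⁻ ω, nexp (∑ i ∈ Finset.range n, u i ω) ∂P) atTop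
      (𝓝 (∫⁻ ω, nexp (∑' i, u i ω) ∂P)) :=
  tendsto_lintegral_of_dominated_convergence (fun _ => 1) (fun n => by fun_prop)
    (fun n => ae_of_all _ fun ω => nexp_le_one _) (by simp)
    (ae_of_all _ fun ω => (continuous_nexp.tendsto _).comp
      ENNReal.summable.hasSum.tendsto_sum_nat)

/-! ### Poisson processes -/

lemma lintegral_pow_poissonMeasure (r b : ℝ≥0) :
    ∫⁻ n : ℕ, (b : ℝ≥0∞) ^ n ∂(poissonMeasure r) =
      ENNReal.ofReal (Real.exp (r * b) * Real.exp (-r)) := by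
  have hsum := (NormedSpace.expSeries_div_hasSum_exp ((r : ℝ) * b)).mul_right (Real.exp (-r))
  rw [← Real.exp_eq_exp_ℝ] at hsum
  rw [poissonMeasure, lintegral_sum_measure, ← hsum.tsum_eq,
    ENNReal.ofReal_tsum_of_nonneg (fun n => by positivity) hsum.summable]
  refine tsum_congr fun n => ?_
  rw [lintegral_smul_measure, lintegral_dirac, smul_eq_mul, ← ENNReal.ofReal_coe_nnreal,
    ← ENNReal.ofReal_pow b.coe_nonneg, ← ENNReal.ofReal_mul (by positivity), mul_pow]
  congr 1
  ring

lemma lintegral_nexp_poissonMeasure (r : ℝ≥0) (a : ℝ≥0∞) :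
    ∫⁻ n : ℕ, nexp (a * n) ∂(poissonMeasure r) = nexp (r * (1 - nexp a)) := by
  simp_rw [nexp_mul_natCast]
  have ha := nexp_le_one a
  lift nexp a to ℝ≥0 using nexp_ne_top a with b
  have hb : b ≤ 1 := by exact_mod_cast ha
  have hexponent : (r : ℝ≥0∞) * (1 - b) = ENNReal.ofReal (r * (1 - b)) := by
    rw [← NNReal.coe_one, ← NNReal.coe_sub hb, ← NNReal.coe_mul, ENNReal.ofReal_coe_nnreal]
    simp
  rw [lintegral_pow_poissonMeasure, hexponent,
    nexp_ofReal (mul_nonneg r.coe_nonneg (sub_nonneg.2 (by exact_mod_cast hb))), ← Real.exp_add]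
  ring_nf

/-- The random points `X 0, X 1, …` have the Laplace functional of a Poisson process with
intensity measure `μ`. This characterizes Poisson processes, and passes to images and to
independent markings more directly than `IsPoissonProcess`. -/
def HasPoissonLaplace {Ω E : Type*} [MeasurableSpace Ω] [MeasurableSpace E]
    (X : ℕ → Ω → E) (μ : Measure E) (P : Measure Ω) : Prop :=
  ∀ h : E → ℝ≥0∞, Measurable h →
    ∫⁻ ω, nexp (∑' i, h (X i ω)) ∂P = nexp (∫⁻ y, (1 - nexp (h y)) ∂μ)

lemma tsum_simpleFunc_eq_sum_mul_count {Ω E : Type*} [MeasurableSpace E] (X : ℕ → Ω → E)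
    (f : SimpleFunc E ℝ≥0∞) (ω : Ω) :
    ∑' i, f (X i ω) = ∑ x ∈ f.range, x * count X (f ⁻¹' {x}) ω := by
  calc ∑' i, f (X i ω) = ∫⁻ y, f y ∂(Measure.sum fun i => Measure.dirac (X i ω)) := by
        rw [lintegral_sum_measure]
        exact tsum_congr fun i => (lintegral_dirac' _ f.measurable).symm
    _ = _ := by rw [SimpleFunc.lintegral_eq_lintegral]; rfl

section

variable {Ω E : Type*} [MeasurableSpace Ω] [MeasurableSpace E] {X : ℕ → Ω → E}
  {μ : Measure E} {P : Measure Ω}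

lemma measurable_count (hX : ∀ i, Measurable (X i)) {A : Set E} (hA : MeasurableSet A) :
    Measurable (count X A) := by
  have : count X A = fun ω => ∑' i, (A.indicator 1 (X i ω) : ℝ≥0∞) := by
    ext ω
    simp only [count, Measure.sum_apply _ hA, Measure.dirac_apply' _ hA]
  rw [this]
  exact Measurable.tsum fun i => (measurable_one.indicator hA).comp (hX i)

lemma lintegral_one_sub_nexp_simpleFunc (f : SimpleFunc E ℝ≥0∞) :
    ∫⁻ y, (1 - nexp (f y)) ∂μ = ∑ x ∈ f.range, μ (f ⁻¹' {x}) * (1 - nexp x) := by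
  calc ∫⁻ y, (1 - nexp (f y)) ∂μ = ∫⁻ y, (f.map fun x => 1 - nexp x) y ∂μ := rfl
    _ = _ := by
        rw [SimpleFunc.lintegral_eq_lintegral, SimpleFunc.map_lintegral]
        simp_rw [mul_comm]

lemma IsPoissonProcess.lintegral_nexp_count (hP : IsPoissonProcess X μ P)
    (hX : ∀ i, Measurable (X i)) {A : Set E} (hA : MeasurableSet A) (hμ : μ A < ∞) (a : ℝ≥0∞) :
    ∫⁻ ω, nexp (a * count X A ω) ∂P = nexp (μ A * (1 - nexp a)) := by
  rw [← lintegral_map (f := fun x => nexp (a * x)) (by fun_prop) (measurable_count hX hA),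
    hP.law A hA hμ, lintegral_map (by fun_prop) (by fun_prop), lintegral_nexp_poissonMeasure,
    ENNReal.coe_toNNReal hμ.ne]

lemma IsPoissonProcess.iIndepFun_count_fiber (hP : IsPoissonProcess X μ P)
    (f : SimpleFunc E ℝ≥0∞) :
    iIndepFun (fun x : f.range => count X (f ⁻¹' {(x : ℝ≥0∞)})) P := by
  let e := f.range.equivFin
  have hfin := hP.indep _ (fun j => f ⁻¹' {((e.symm j : f.range) : ℝ≥0∞)})
    (fun j => f.measurableSet_fiber _) fun i j hij =>
      Disjoint.preimage _ (disjoint_singleton.2 fun h => hij (e.symm.injective (Subtype.ext h)))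
  simpa only [e.symm_apply_apply] using hfin.precomp e.injective

lemma IsPoissonProcess.lintegral_nexp_simpleFunc (hP : IsPoissonProcess X μ P)
    (hX : ∀ i, Measurable (X i)) (f : SimpleFunc E ℝ≥0∞) (hf : ∀ x ≠ 0, μ (f ⁻¹' {x}) < ∞) :
    ∫⁻ ω, nexp (∑' i, f (X i ω)) ∂P = nexp (∫⁻ y, (1 - nexp (f y)) ∂μ) := by
  have hind := hP.iIndepFun_count_fiber f
  have : IsProbabilityMeasure P := hind.isProbabilityMeasure
  have hcount (x : ℝ≥0∞) : ∫⁻ ω, nexp (x * count X (f ⁻¹' {x}) ω) ∂P =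
      nexp (μ (f ⁻¹' {x}) * (1 - nexp x)) := by
    by_cases h0 : x = 0
    · simp [h0]
    · exact hP.lintegral_nexp_count hX (f.measurableSet_fiber _) (hf _ h0) _
  simp_rw [tsum_simpleFunc_eq_sum_mul_count, lintegral_one_sub_nexp_simpleFunc, nexp_sum,
    ← Finset.prod_coe_sort f.range]
  rw [lintegral_prod_eq_prod_lintegral_of_indepFun (μ := P) Finset.univ
    (fun (x : f.range) ω => nexp (x * count X (f ⁻¹' {(x : ℝ≥0∞)}) ω))]
  · exact Finset.prod_congr rfl fun x _ => hcount x
  · exact hind.comp (fun x y => nexp (x * y)) fun x => by fun_prop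
  · exact fun x => measurable_nexp.comp
      ((measurable_count hX (f.measurableSet_fiber _)).const_mul _)

/-- Simple functions with support of finite measure which increase to the function `h`. -/
def restrictedApprox (μ : Measure E) [SigmaFinite μ] (h : E → ℝ≥0∞) (n : ℕ) :
    SimpleFunc E ℝ≥0∞ :=
  (SimpleFunc.eapprox h n).restrict (spanningSets μ n)

section restrictedApprox

variable [SigmaFinite μ]

lemma restrictedApprox_apply (h : E → ℝ≥0∞) (n : ℕ) (y : E) :
    restrictedApprox μ h n y = (spanningSets μ n).indicator (SimpleFunc.eapprox h n) y :=
  SimpleFunc.restrict_apply _ (measurableSet_spanningSets μ n) y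

lemma monotone_restrictedApprox (h : E → ℝ≥0∞) (y : E) :
    Monotone fun n => restrictedApprox μ h n y := by
  intro n k hnk
  simp only [restrictedApprox_apply]
  calc _ ≤ (spanningSets μ n).indicator (SimpleFunc.eapprox h k) y :=
        indicator_le_indicator (SimpleFunc.monotone_eapprox h hnk y)
    _ ≤ _ := indicator_le_indicator_of_subset (monotone_spanningSets μ hnk) (fun _ => zero_le) y

lemma tendsto_restrictedApprox {h : E → ℝ≥0∞} (hh : Measurable h) (y : E) :
    Tendsto (fun n => restrictedApprox μ h n y) atTop (𝓝 (h y)) := by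
  refine (SimpleFunc.tendsto_eapprox hh y).congr' ?_
  filter_upwards [eventually_ge_atTop (spanningSetsIndex μ y)] with n hn
  rw [restrictedApprox_apply, indicator_of_mem]
  exact monotone_spanningSets μ hn (mem_spanningSetsIndex μ y)

lemma measure_restrictedApprox_fiber_lt_top (h : E → ℝ≥0∞) (n : ℕ) {x : ℝ≥0∞} (hx : x ≠ 0) :
    μ (restrictedApprox μ h n ⁻¹' {x}) < ∞ := by
  refine (measure_mono fun y hy => ?_).trans_lt (measure_spanningSets_lt_top μ n)
  refine mem_of_indicator_ne_zero (f := SimpleFunc.eapprox h n) ?_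
  rwa [← restrictedApprox_apply, mem_singleton_iff.1 hy]

lemma tendsto_tsum_restrictedApprox {h : E → ℝ≥0∞} (hh : Measurable h) (x : ℕ → E) :
    Tendsto (fun n => ∑' i, restrictedApprox μ h n (x i)) atTop (𝓝 (∑' i, h (x i))) := by
  simp_rw [← lintegral_count]
  exact lintegral_tendsto_of_tendsto_of_monotone (fun n => by fun_prop)
    (ae_of_all _ fun i => monotone_restrictedApprox h _)
    (ae_of_all _ fun i => tendsto_restrictedApprox hh _)

lemma tendsto_lintegral_one_sub_nexp_restrictedApprox {h : E → ℝ≥0∞} (hh : Measurable h) :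
    Tendsto (fun n => ∫⁻ y, (1 - nexp (restrictedApprox μ h n y)) ∂μ) atTop
      (𝓝 (∫⁻ y, (1 - nexp (h y)) ∂μ)) := by
  refine lintegral_tendsto_of_tendsto_of_monotone (fun n => by fun_prop)
    (ae_of_all _ fun y n k hnk =>
      tsub_le_tsub_left (antitone_nexp (monotone_restrictedApprox h y hnk)) _)
    (ae_of_all _ fun y => ?_)
  exact ENNReal.Tendsto.sub tendsto_const_nhds
    ((continuous_nexp.tendsto _).comp (tendsto_restrictedApprox hh y)) (.inl ENNReal.one_ne_top)

end restrictedApprox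

lemma IsPoissonProcess.hasPoissonLaplace [SigmaFinite μ] [IsFiniteMeasure P]
    (hP : IsPoissonProcess X μ P) (hX : ∀ i, Measurable (X i)) : HasPoissonLaplace X μ P := by
  intro h hh
  have hleft : Tendsto (fun n => ∫⁻ ω, nexp (∑' i, restrictedApprox μ h n (X i ω)) ∂P) atTop
      (𝓝 (∫⁻ ω, nexp (∑' i, h (X i ω)) ∂P)) :=
    tendsto_lintegral_of_dominated_convergence (fun _ => 1) (fun n => by fun_prop)
      (fun n => ae_of_all _ fun ω => nexp_le_one _) (by simp)
      (ae_of_all _ fun ω => (continuous_nexp.tendsto _).comp (tendsto_tsum_restrictedApprox hh _))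
  have hright := (continuous_nexp.tendsto _).comp
    (tendsto_lintegral_one_sub_nexp_restrictedApprox (μ := μ) hh)
  exact tendsto_nhds_unique hleft (hright.congr fun n => (hP.lintegral_nexp_simpleFunc hX _
    fun x hx => measure_restrictedApprox_fiber_lt_top h n hx).symm)

end

section

variable {Ω E F : Type*} [MeasurableSpace Ω] [MeasurableSpace E] [MeasurableSpace F]
  {P : Measure Ω}

lemma HasPoissonLaplace.map {X : ℕ → Ω → E} {μ : Measure E} (hX : HasPoissonLaplace X μ P)
    {φ : E → F} (hφ : Measurable φ) :
    HasPoissonLaplace (fun i ω => φ (X i ω)) (μ.map φ) P := by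
  intro h hh
  rw [hX (fun x => h (φ x)) (hh.comp hφ), lintegral_map (by fun_prop) hφ]

lemma lintegral_comp_eq_lintegral_lintegral_of_indepFun [IsFiniteMeasure P] {X : Ω → E}
    {Y : Ω → F} (hX : Measurable X) (hY : Measurable Y) (hXY : IndepFun X Y P)
    {f : E → F → ℝ≥0∞} (hf : Measurable (Function.uncurry f)) :
    ∫⁻ ω, f (X ω) (Y ω) ∂P = ∫⁻ ω, ∫⁻ ω', f (X ω') (Y ω) ∂P ∂P := by
  calc ∫⁻ ω, f (X ω) (Y ω) ∂P
      = ∫⁻ z, Function.uncurry f z ∂(P.map fun ω => (X ω, Y ω)) :=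
        (lintegral_map hf (hX.prodMk hY)).symm
    _ = ∫⁻ y, ∫⁻ x, f x y ∂(P.map X) ∂(P.map Y) := by
        rw [(indepFun_iff_map_prod_eq_prod_map_map hX.aemeasurable hY.aemeasurable).1 hXY,
          lintegral_prod_symm' _ hf]
        rfl
    _ = ∫⁻ ω, ∫⁻ ω', f (X ω') (Y ω) ∂P ∂P := by
        refine (lintegral_map hf.lintegral_prod_left' hY).trans (lintegral_congr fun ω => ?_)
        exact lintegral_map (hf.comp measurable_prodMk_right) hX

lemma lintegral_nexp_sum_marked [IsFiniteMeasure P] {pos : ℕ → Ω → E} {mark : ℕ → Ω → F}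
    {ν : Measure F} (hpos : ∀ i, Measurable (pos i)) (hmark : ∀ i, Measurable (mark i))
    (hν : ∀ i, P.map (mark i) = ν) (hind : iIndepFun mark P)
    (hindpos : IndepFun (fun ω i => mark i ω) (fun ω i => pos i ω) P) {f : E × F → ℝ≥0∞}
    (hf : Measurable f) (n : ℕ) :
    ∫⁻ ω, nexp (∑ i ∈ Finset.range n, f (pos i ω, mark i ω)) ∂P =
      ∫⁻ ω, ∏ i ∈ Finset.range n, ∫⁻ m, nexp (f (pos i ω, m)) ∂ν ∂P := by
  rw [lintegral_comp_eq_lintegral_lintegral_of_indepFun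
    (f := fun (m : ℕ → F) (y : ℕ → E) => nexp (∑ i ∈ Finset.range n, f (y i, m i)))
    (measurable_pi_lambda _ hmark) (measurable_pi_lambda _ hpos) hindpos (by fun_prop)]
  refine lintegral_congr fun ω => ?_
  have hmeas (i : ℕ) : Measurable fun m => nexp (f (pos i ω, m)) := by fun_prop
  simp only [nexp_sum]
  rw [lintegral_prod_eq_prod_lintegral_of_indepFun (μ := P) _
    (fun i ω' => nexp (f (pos i ω, mark i ω')))
    (hind.comp (fun i m => nexp (f (pos i ω, m))) hmeas) fun i => (hmeas i).comp (hmark i)]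
  exact Finset.prod_congr rfl fun i _ => by rw [← hν i, lintegral_map (hmeas i) (hmark i)]

-- With `g y = ∫⁻ m, nexp (f (y, m)) ∂ν`, averaging over the marks replaces `f` by `nlog ∘ g`, a
-- function of the positions alone.
lemma HasPoissonLaplace.prodMk [IsProbabilityMeasure P] {pos : ℕ → Ω → E} {mark : ℕ → Ω → F}
    {μ : Measure E} {ν : Measure F} (h : HasPoissonLaplace pos μ P)
    (hpos : ∀ i, Measurable (pos i)) (hmark : ∀ i, Measurable (mark i))
    (hν : ∀ i, P.map (mark i) = ν) (hind : iIndepFun mark P)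
    (hindpos : IndepFun (fun ω i => mark i ω) (fun ω i => pos i ω) P) :
    HasPoissonLaplace (fun i ω => (pos i ω, mark i ω)) (μ.prod ν) P := by
  intro f hf
  have : IsProbabilityMeasure ν := by
    rw [← hν 0]
    exact Measure.isProbabilityMeasure_map (hmark 0).aemeasurable
  let g : E → ℝ≥0∞ := fun y => ∫⁻ m, nexp (f (y, m)) ∂ν
  have hg : Measurable g := (measurable_nexp.comp hf).lintegral_prod_right'
  have hg1 (y : E) : g y ≤ 1 := (lintegral_mono fun m => nexp_le_one (f (y, m))).trans (by simp)
  have hfin (n : ℕ) : ∫⁻ ω, nexp (∑ i ∈ Finset.range n, f (pos i ω, mark i ω)) ∂P =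
      ∫⁻ ω, nexp (∑ i ∈ Finset.range n, nlog (g (pos i ω))) ∂P := by
    simp_rw [lintegral_nexp_sum_marked hpos hmark hν hind hindpos hf n, nexp_sum,
      nexp_nlog (hg1 _), g]
  have hmarked := tendsto_lintegral_nexp_sum (P := P) (u := fun i ω => f (pos i ω, mark i ω))
    fun i => by fun_prop
  have haveraged := tendsto_lintegral_nexp_sum (P := P) (u := fun i ω => nlog (g (pos i ω)))
    fun i => by fun_prop
  calc ∫⁻ ω, nexp (∑' i, f (pos i ω, mark i ω)) ∂P
      = ∫⁻ ω, nexp (∑' i, nlog (g (pos i ω))) ∂P :=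
        tendsto_nhds_unique hmarked (haveraged.congr fun n => (hfin n).symm)
    _ = nexp (∫⁻ y, (1 - g y) ∂μ) := by
        simp_rw [h (fun y => nlog (g y)) (by fun_prop), nexp_nlog (hg1 _)]
    _ = nexp (∫⁻ z, (1 - nexp (f z)) ∂(μ.prod ν)) := by
        rw [lintegral_prod _ (by fun_prop)]
        congr 1
        refine lintegral_congr fun y => ?_
        rw [lintegral_sub (by fun_prop) ((hg1 y).trans_lt ENNReal.one_lt_top).ne
          (ae_of_all _ fun m => nexp_le_one _)]
        simp [g]

end

/-! ### Conditioning on the smallest point -/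

/-- The smallest multiple of `1 / (n + 1)` which is greater than `l`. -/
def gridAbove (n : ℕ) (l : ℝ) : ℝ := (⌊(n + 1) * l⌋ + 1) / (n + 1)

lemma lt_gridAbove (n : ℕ) (l : ℝ) : l < gridAbove n l := by
  rw [gridAbove, lt_div_iff₀ (by positivity), mul_comm]
  exact Int.lt_floor_add_one _

lemma gridAbove_le (n : ℕ) (l : ℝ) : gridAbove n l ≤ l + 1 / (n + 1) := by
  have : (0 : ℝ) < n + 1 := by positivity
  rw [gridAbove, div_le_iff₀ this, add_mul l, one_div_mul_cancel this.ne', mul_comm l]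
  gcongr
  exact Int.floor_le _

lemma tendsto_gridAbove (l : ℝ) : Tendsto (fun n => gridAbove n l) atTop (𝓝[>] l) := by
  refine tendsto_nhdsWithin_iff.2 ⟨?_, .of_forall fun n => lt_gridAbove n l⟩
  refine tendsto_of_tendsto_of_tendsto_of_le_of_le tendsto_const_nhds ?_
    (fun n => (lt_gridAbove n l).le) fun n => gridAbove_le n l
  simpa using tendsto_const_nhds.add (tendsto_one_div_add_atTop_nhds_zero_nat (𝕜 := ℝ))

@[fun_prop] lemma measurable_gridAbove (n : ℕ) : Measurable (gridAbove n) :=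
  (measurable_from_top (f := fun z : ℤ => ((z : ℝ) + 1) / (n + 1))).comp
    (Int.measurable_floor.comp (measurable_const_mul ((n : ℝ) + 1)))

lemma countable_range_gridAbove (n : ℕ) : (range (gridAbove n)).Countable :=
  (countable_range fun z : ℤ => ((z : ℝ) + 1) / (n + 1)).mono
    (range_subset_iff.2 fun l => mem_range_self ⌊(n + 1) * l⌋)

lemma setLIntegral_eq_tsum_fiber {α β : Type*} [MeasurableSpace α] [MeasurableSpace β]
    [MeasurableSingletonClass β] {μ : Measure α} {g : α → β} (hg : Measurable g) {t : Set β}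
    (ht : t.Countable) (hgt : ∀ a, g a ∈ t) (F : β → α → ℝ≥0∞) {A : Set α}
    (hA : MeasurableSet A) :
    ∫⁻ a in A, F (g a) a ∂μ = ∑' b : t, ∫⁻ a in A ∩ g ⁻¹' {↑b}, F b a ∂μ := by
  have hmeas (b : β) : MeasurableSet (A ∩ g ⁻¹' {b}) := hA.inter (hg (measurableSet_singleton b))
  have hunion : A = ⋃ b ∈ t, A ∩ g ⁻¹' {b} := by
    ext a
    simp [hgt]
  conv_lhs => rw [hunion]
  rw [lintegral_biUnion ht fun b _ => hmeas b]
  · exact tsum_congr fun b => setLIntegral_congr_fun (hmeas b) fun a ha => by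
      rw [mem_singleton_iff.1 ha.2]
  · exact fun b _ b' _ hb => Disjoint.mono inter_subset_right inter_subset_right
      (Disjoint.preimage g (disjoint_singleton.2 hb))

section

variable {Ω : Type*} [MeasurableSpace Ω] {P : Measure Ω} {Φ : ℝ → Ω → ℝ≥0∞} {φ : ℝ → ℝ≥0∞}
  {T : Ω → ℝ} {B : Set ℝ}

lemma setLIntegral_gridAbove_comp (hT : Measurable T)
    (h : ∀ b C, MeasurableSet C → C ⊆ Iio b →
      ∫⁻ ω in T ⁻¹' C, Φ b ω ∂P = φ b * P (T ⁻¹' C))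
    (hB : MeasurableSet B) (n : ℕ) :
    ∫⁻ ω in T ⁻¹' B, Φ (gridAbove n (T ω)) ω ∂P =
      ∫⁻ l in B, φ (gridAbove n l) ∂(P.map T) := by
  rw [setLIntegral_eq_tsum_fiber (g := fun ω => gridAbove n (T ω))
      ((measurable_gridAbove n).comp hT) (countable_range_gridAbove n)
      (fun ω => mem_range_self _) Φ (hT hB),
    setLIntegral_eq_tsum_fiber (measurable_gridAbove n) (countable_range_gridAbove n)
      (fun l => mem_range_self _) (fun b _ => φ b) hB]
  refine tsum_congr fun b => ?_
  have hC : MeasurableSet (B ∩ gridAbove n ⁻¹' {↑b}) :=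
    hB.inter (measurable_gridAbove n (measurableSet_singleton _))
  have hCb : B ∩ gridAbove n ⁻¹' {↑b} ⊆ Iio (b : ℝ) := fun l hl =>
    (lt_gridAbove n l).trans_eq hl.2
  have hpre : T ⁻¹' B ∩ (fun ω => gridAbove n (T ω)) ⁻¹' {↑b} =
      T ⁻¹' (B ∩ gridAbove n ⁻¹' {↑b}) := rfl
  rw [hpre, h b _ hC hCb, setLIntegral_const,
    Measure.map_apply hT hC]

-- `T` is approximated from above by functions with countably many values.
lemma setLIntegral_comp_eq_setLIntegral_map [IsFiniteMeasure P]
    (hΦ : Measurable (Function.uncurry Φ)) (hΦ1 : ∀ b ω, Φ b ω ≤ 1)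
    (hΦr : ∀ l ω, Tendsto (fun b => Φ b ω) (𝓝[>] l) (𝓝 (Φ l ω)))
    (hφ : Measurable φ) (hφ1 : ∀ b, φ b ≤ 1)
    (hφr : ∀ l, Tendsto φ (𝓝[>] l) (𝓝 (φ l))) (hT : Measurable T)
    (h : ∀ b C, MeasurableSet C → C ⊆ Iio b →
      ∫⁻ ω in T ⁻¹' C, Φ b ω ∂P = φ b * P (T ⁻¹' C))
    (hB : MeasurableSet B) :
    ∫⁻ ω in T ⁻¹' B, Φ (T ω) ω ∂P = ∫⁻ l in B, φ l ∂(P.map T) := by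
  have hleft : Tendsto (fun n => ∫⁻ ω in T ⁻¹' B, Φ (gridAbove n (T ω)) ω ∂P) atTop
      (𝓝 (∫⁻ ω in T ⁻¹' B, Φ (T ω) ω ∂P)) :=
    tendsto_lintegral_of_dominated_convergence (fun _ => 1)
      (fun n => hΦ.comp (((measurable_gridAbove n).comp hT).prodMk measurable_id))
      (fun n => ae_of_all _ fun ω => hΦ1 _ ω) (by simp)
      (ae_of_all _ fun ω => (hΦr _ ω).comp (tendsto_gridAbove _))
  have hright : Tendsto (fun n => ∫⁻ l in B, φ (gridAbove n l) ∂(P.map T)) atTop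
      (𝓝 (∫⁻ l in B, φ l ∂(P.map T))) :=
    tendsto_lintegral_of_dominated_convergence (fun _ => 1)
      (fun n => hφ.comp (measurable_gridAbove n)) (fun n => ae_of_all _ fun l => hφ1 _) (by simp)
      (ae_of_all _ fun l => (hφr l).comp (tendsto_gridAbove l))
  exact tendsto_nhds_unique hleft (hright.congr fun n =>
    (setLIntegral_gridAbove_comp hT h hB n).symm)

end

lemma tendsto_measure_Ioi (ρ : Measure ℝ) (l : ℝ) :
    Tendsto (fun b => ρ (Ioi b)) (𝓝[>] l) (𝓝 (ρ (Ioi l))) := by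
  have hunion : ⋃ b : Ioi l, Ioi (b : ℝ) = Ioi l := by
    ext x
    simpa using ⟨fun ⟨b, hb, hx⟩ => hb.trans hx, exists_between⟩
  have hlim := tendsto_measure_iUnion_atBot (μ := ρ) (s := fun b : Ioi l => Ioi (b : ℝ))
    fun a b hab => Ioi_subset_Ioi hab
  rw [hunion] at hlim
  exact (tendsto_comp_coe_Ioi_atBot (f := fun b => ρ (Ioi b)) (.of_dense l)).1 hlim

/-- Sum of the second components of the points whose first component exceeds `b`: the
interference from the base stations of path loss greater than `b`. -/
def sumAbove {Ω : Type*} (W : ℕ → Ω → ℝ × ℝ≥0∞) (b : ℝ) (ω : Ω) : ℝ≥0∞ :=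
  ∑' i, {w : ℝ × ℝ≥0∞ | b < w.1}.indicator Prod.snd (W i ω)

/-- Laplace transform of `sumAbove` for a Poisson process with intensity measure `κ`. -/
def laplaceAbove (κ : Measure (ℝ × ℝ≥0∞)) (b : ℝ) : ℝ≥0∞ :=
  nexp (∫⁻ w in {w | b < w.1}, (1 - nexp w.2) ∂κ)

lemma tendsto_sumAbove {Ω : Type*} (W : ℕ → Ω → ℝ × ℝ≥0∞) (l : ℝ) (ω : Ω) :
    Tendsto (fun b => sumAbove W b ω) (𝓝[>] l) (𝓝 (sumAbove W l ω)) := by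
  have hmeasure (b : ℝ) : sumAbove W b ω =
      (Measure.sum fun i => (W i ω).2 • Measure.dirac (W i ω).1) (Ioi b) := by
    rw [Measure.sum_apply _ measurableSet_Ioi]
    refine tsum_congr fun i => ?_
    simp [Measure.dirac_apply' _ measurableSet_Ioi, indicator_apply]
  simp_rw [hmeasure]
  exact tendsto_measure_Ioi _ l

lemma tendsto_laplaceAbove (κ : Measure (ℝ × ℝ≥0∞)) (l : ℝ) :
    Tendsto (laplaceAbove κ) (𝓝[>] l) (𝓝 (laplaceAbove κ l)) := by
  have hmeasure : laplaceAbove κ = fun b =>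
      nexp (((κ.withDensity fun w => 1 - nexp w.2).map Prod.fst) (Ioi b)) := by
    ext b
    rw [Measure.map_apply measurable_fst measurableSet_Ioi,
      withDensity_apply _ (measurable_fst measurableSet_Ioi)]
    rfl
  rw [hmeasure]
  exact (continuous_nexp.tendsto _).comp (tendsto_measure_Ioi _ l)

lemma measurable_laplaceAbove (κ : Measure (ℝ × ℝ≥0∞)) : Measurable (laplaceAbove κ) :=
  Monotone.measurable fun _ _ hab =>
    antitone_nexp (lintegral_mono_set fun _ hw => lt_of_le_of_lt hab hw)

section

variable {Ω : Type*} [MeasurableSpace Ω] {P : Measure Ω} {W : ℕ → Ω → ℝ × ℝ≥0∞}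
  {κ : Measure (ℝ × ℝ≥0∞)} {T : Ω → ℝ}

lemma measurable_sumAbove (hW : ∀ i, Measurable (W i)) :
    Measurable (Function.uncurry (sumAbove W)) := by
  refine Measurable.tsum fun i => ?_
  simp only [indicator_apply, mem_ofPred_eq]
  exact Measurable.ite (measurableSet_lt (by fun_prop) (by fun_prop)) (by fun_prop) (by fun_prop)

-- The restrictions of a Poisson process to disjoint sets are independent.
lemma HasPoissonLaplace.lintegral_nexp_tsum_add {E : Type*} [MeasurableSpace E] {X : ℕ → Ω → E}
    {μ : Measure E} (hX : HasPoissonLaplace X μ P) {f g : E → ℝ≥0∞} (hf : Measurable f)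
    (hg : Measurable g) (hfg : ∀ x, f x = 0 ∨ g x = 0) :
    ∫⁻ ω, nexp (∑' i, f (X i ω) + ∑' i, g (X i ω)) ∂P =
      (∫⁻ ω, nexp (∑' i, f (X i ω)) ∂P) * ∫⁻ ω, nexp (∑' i, g (X i ω)) ∂P := by
  simp_rw [← ENNReal.tsum_add]
  rw [hX f hf, hX g hg, hX (fun x => f x + g x) (hf.add hg), ← nexp_add,
    ← lintegral_add_left (by fun_prop)]
  congr 1
  refine lintegral_congr fun x => ?_
  rcases hfg x with h | h <;> simp [h]

lemma HasPoissonLaplace.lintegral_nexp_sumAbove (hκ : HasPoissonLaplace W κ P) (b : ℝ) :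
    ∫⁻ ω, nexp (sumAbove W b ω) ∂P = laplaceAbove κ b := by
  have hs : MeasurableSet {w : ℝ × ℝ≥0∞ | b < w.1} := measurableSet_lt (by fun_prop) (by fun_prop)
  refine (hκ _ (measurable_snd.indicator hs)).trans ?_
  rw [laplaceAbove, ← lintegral_indicator hs]
  congr 1
  refine lintegral_congr fun w => ?_
  by_cases h : b < w.1 <;> simp [h]

lemma nexp_tsum_indicator_top {ι : Type*} {x : ι → ℝ} {t : ℝ} (ht : IsLeast (range x) t)
    (a : ℝ) : nexp (∑' i, (Iio a).indicator (fun _ => ∞) (x i)) = (Ici a).indicator 1 t := by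
  by_cases h : a ≤ t
  · have hzero (i : ι) : (Iio a).indicator (fun _ => (∞ : ℝ≥0∞)) (x i) = 0 :=
      indicator_of_notMem (notMem_Iio.2 (h.trans (ht.2 (mem_range_self i)))) _
    simp [hzero, h]
  · obtain ⟨i, rfl⟩ := ht.1
    have htop : ∑' i, (Iio a).indicator (fun _ => (∞ : ℝ≥0∞)) (x i) = ∞ :=
      ENNReal.tsum_eq_top_of_eq_top ⟨i, indicator_of_mem (mem_Iio.2 (not_le.1 h)) _⟩
    simp [htop, h]

-- The event `a ≤ T` is a void event of the process below `a`.
lemma HasPoissonLaplace.setLIntegral_nexp_sumAbove_Ici (hκ : HasPoissonLaplace W κ P)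
    (hT : Measurable T) (hmin : ∀ᵐ ω ∂P, IsLeast (range fun i => (W i ω).1) (T ω)) {a b : ℝ}
    (hab : a ≤ b) :
    ∫⁻ ω in T ⁻¹' Ici a, nexp (sumAbove W b ω) ∂P = laplaceAbove κ b * P (T ⁻¹' Ici a) := by
  have hA : MeasurableSet (T ⁻¹' Ici a) := hT measurableSet_Ici
  let below (w : ℝ × ℝ≥0∞) : ℝ≥0∞ := (Iio a).indicator (fun _ => ∞) w.1
  have hvoid : ∀ᵐ ω ∂P, nexp (∑' i, below (W i ω)) = (T ⁻¹' Ici a).indicator 1 ω :=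
    hmin.mono fun ω hω => nexp_tsum_indicator_top hω a
  have hdisjoint (w : ℝ × ℝ≥0∞) :
      {w : ℝ × ℝ≥0∞ | b < w.1}.indicator Prod.snd w = 0 ∨ below w = 0 := by
    by_cases h : b < w.1
    · exact .inr (indicator_of_notMem (notMem_Iio.2 (hab.trans h.le)) _)
    · exact .inl (indicator_of_notMem (s := {w : ℝ × ℝ≥0∞ | b < w.1}) h _)
  calc ∫⁻ ω in T ⁻¹' Ici a, nexp (sumAbove W b ω) ∂P
      = ∫⁻ ω, nexp (sumAbove W b ω + ∑' i, below (W i ω)) ∂P := by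
        rw [← lintegral_indicator hA]
        refine lintegral_congr_ae (hvoid.mono fun ω hω => ?_)
        by_cases h : ω ∈ T ⁻¹' Ici a <;> simp [nexp_add, hω, h]
    _ = (∫⁻ ω, nexp (sumAbove W b ω) ∂P) * ∫⁻ ω, nexp (∑' i, below (W i ω)) ∂P :=
        hκ.lintegral_nexp_tsum_add
          (measurable_snd.indicator (measurableSet_lt (by fun_prop) (by fun_prop)))
          ((measurable_const.indicator measurableSet_Iio).comp measurable_fst) hdisjoint
    _ = laplaceAbove κ b * P (T ⁻¹' Ici a) := by
        rw [hκ.lintegral_nexp_sumAbove, lintegral_congr_ae hvoid, lintegral_indicator_one hA]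

lemma HasPoissonLaplace.setLIntegral_nexp_sumAbove (hκ : HasPoissonLaplace W κ P)
    (hT : Measurable T) (hmin : ∀ᵐ ω ∂P, IsLeast (range fun i => (W i ω).1) (T ω))
    {b : ℝ} {C : Set ℝ} (hC : MeasurableSet C) (hCb : C ⊆ Iio b) :
    ∫⁻ ω in T ⁻¹' C, nexp (sumAbove W b ω) ∂P = laplaceAbove κ b * P (T ⁻¹' C) := by
  have hfinite : IsFiniteMeasure (P.withDensity fun ω => nexp (sumAbove W b ω)) :=
    isFiniteMeasure_withDensity (by
      rw [hκ.lintegral_nexp_sumAbove b]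
      exact nexp_ne_top _)
  have hmeas : Measurable fun ω => min b (T ω) := measurable_const.min hT
  have heq : (P.withDensity fun ω => nexp (sumAbove W b ω)).map (fun ω => min b (T ω)) =
      laplaceAbove κ b • P.map fun ω => min b (T ω) := by
    refine Measure.ext_of_Ici _ _ fun a => ?_
    rw [Measure.smul_apply, smul_eq_mul, Measure.map_apply hmeas measurableSet_Ici,
      Measure.map_apply hmeas measurableSet_Ici, withDensity_apply _ (hmeas measurableSet_Ici)]
    rcases le_or_gt a b with hab | hab
    · have hpre : (fun ω => min b (T ω)) ⁻¹' Ici a = T ⁻¹' Ici a := by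
        ext ω
        simp [hab]
      rw [hpre, hκ.setLIntegral_nexp_sumAbove_Ici hT hmin hab]
    · have hpre : (fun ω => min b (T ω)) ⁻¹' Ici a = ∅ := by
        ext ω
        simp [hab]
      simp [hpre]
  have hpre : (fun ω => min b (T ω)) ⁻¹' C = T ⁻¹' C := by
    ext ω
    rcases le_or_gt b (T ω) with h | h
    · simp only [mem_preimage, min_eq_left h]
      exact iff_of_false (fun hb => lt_irrefl b (hCb hb)) fun hb => (hCb hb).not_ge h
    · simp [min_eq_right h.le]
  have := DFunLike.congr_fun heq C
  rwa [Measure.smul_apply, smul_eq_mul, Measure.map_apply hmeas hC, Measure.map_apply hmeas hC,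
    withDensity_apply _ (hmeas hC), hpre] at this

theorem HasPoissonLaplace.setLIntegral_nexp_tsum_ne_min [IsFiniteMeasure P]
    (hκ : HasPoissonLaplace W κ P) (hW : ∀ i, Measurable (W i)) {S : Ω → ℕ}
    (hS : Measurable fun ω => (W (S ω) ω).1)
    (hmin : ∀ᵐ ω ∂P, ∀ i, i ≠ S ω → (W (S ω) ω).1 < (W i ω).1) {B : Set ℝ}
    (hB : MeasurableSet B) :
    ∫⁻ ω in (fun ω => (W (S ω) ω).1) ⁻¹' B, nexp (∑' i, if i = S ω then 0 else (W i ω).2) ∂P =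
      ∫⁻ l in B, laplaceAbove κ l ∂(P.map fun ω => (W (S ω) ω).1) := by
  have hsum : ∀ᵐ ω ∂P, nexp (∑' i, if i = S ω then 0 else (W i ω).2) =
      nexp (sumAbove W (W (S ω) ω).1 ω) := by
    filter_upwards [hmin] with ω hω
    congr 1
    refine tsum_congr fun i => ?_
    by_cases h : i = S ω
    · simp [h]
    · simp [h, hω i h]
  have hleast : ∀ᵐ ω ∂P, IsLeast (range fun i => (W i ω).1) (W (S ω) ω).1 := by
    filter_upwards [hmin] with ω hω
    refine ⟨mem_range_self _, forall_mem_range.2 fun i => ?_⟩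
    rcases eq_or_ne i (S ω) with rfl | h
    · exact le_rfl
    · exact (hω i h).le
  rw [lintegral_congr_ae (ae_restrict_of_ae hsum)]
  exact setLIntegral_comp_eq_setLIntegral_map (Φ := fun b ω => nexp (sumAbove W b ω))
    (measurable_nexp.comp (measurable_sumAbove hW)) (fun _ _ => nexp_le_one _)
    (fun l ω => (continuous_nexp.tendsto _).comp (tendsto_sumAbove W l ω))
    (measurable_laplaceAbove κ) (fun _ => nexp_le_one _) (tendsto_laplaceAbove κ) hS
    (fun b C hC hCb => hκ.setLIntegral_nexp_sumAbove hS hleast hC hCb) hB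

end

/-! ### Gaussian integrals -/

lemma gaussianPDFReal_mul_exp (c x : ℝ) :
    gaussianPDFReal 0 1 x * Real.exp (-(c * x)) =
      Real.exp (c ^ 2 / 2) * gaussianPDFReal 0 1 (x + c) := by
  have hsquare : Real.exp (-x ^ 2 / 2) * Real.exp (-(c * x)) =
      Real.exp (c ^ 2 / 2) * Real.exp (-(x + c) ^ 2 / 2) := by
    rw [← Real.exp_add, ← Real.exp_add]
    ring_nf
  simp only [gaussianPDFReal, NNReal.coe_one, mul_one, sub_zero]
  linear_combination (√(2 * Real.pi))⁻¹ * hsquare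

lemma integral_mul_exp_gaussianReal (c : ℝ) (f : ℝ → ℝ) :
    ∫ x, f x * Real.exp (-(c * x)) ∂(gaussianReal 0 1) =
      Real.exp (c ^ 2 / 2) * ∫ x, f (x - c) ∂(gaussianReal 0 1) := by
  rw [integral_gaussianReal_eq_integral_smul one_ne_zero,
    integral_gaussianReal_eq_integral_smul one_ne_zero, ← integral_const_mul,
    ← integral_add_right_eq_self (fun x => Real.exp (c ^ 2 / 2) * _) c]
  refine integral_congr_ae (ae_of_all _ fun x => ?_)
  simp only [smul_eq_mul, add_sub_cancel_right]
  linear_combination f x * gaussianPDFReal_mul_exp c x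

lemma integrable_exp_neg_mul_gaussianReal (c : ℝ) :
    Integrable (fun x => Real.exp (-(c * x))) (gaussianReal 0 1) := by
  simpa [neg_mul] using integrable_exp_mul_gaussianReal (μ := 0) (v := 1) (-c)

lemma setIntegral_Ioi_exp_gaussianReal (a c : ℝ) :
    ∫ x in Ioi a, Real.exp (-(c * x)) ∂(gaussianReal 0 1) = Real.exp (c ^ 2 / 2) * Q (c + a) := by
  have hshift : (fun x => (Ioi a).indicator (1 : ℝ → ℝ) (x - c)) = (Ioi (c + a)).indicator 1 := by
    ext x
    simp [indicator_apply, lt_sub_iff_add_lt']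
  calc ∫ x in Ioi a, Real.exp (-(c * x)) ∂(gaussianReal 0 1)
      = ∫ x, (Ioi a).indicator 1 x * Real.exp (-(c * x)) ∂(gaussianReal 0 1) := by
        rw [← integral_indicator measurableSet_Ioi]
        simp [indicator_apply]
    _ = Real.exp (c ^ 2 / 2) * Q (c + a) := by
        rw [integral_mul_exp_gaussianReal, hshift, integral_indicator_one measurableSet_Ioi, Q]

lemma gaussianReal_real_Iic_neg (x : ℝ) : (gaussianReal 0 1).real (Iic (-x)) = Q x := by
  have := nullSingletonClass_gaussianReal (μ := 0) (v := 1) one_ne_zero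
  have hneg : (gaussianReal 0 1).map (fun y => -y) = gaussianReal 0 1 := by
    simpa using gaussianReal_map_neg (μ := 0) (v := 1)
  calc (gaussianReal 0 1).real (Iic (-x))
      = ((gaussianReal 0 1).map fun y => -y).real (Iic (-x)) := by rw [hneg]
    _ = (gaussianReal 0 1).real (Ici x) := by
        rw [map_measureReal_apply measurable_neg measurableSet_Iic]
        simp
    _ = Q x := measureReal_congr Ioi_ae_eq_Ici.symm

lemma Q_eq_integral (x : ℝ) : Q x = ∫ y in Ioi x, gaussianPDFReal 0 1 y := by
  rw [Q, measureReal_def, gaussianReal_apply_eq_integral 0 one_ne_zero, ENNReal.toReal_ofReal]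
  exact integral_nonneg fun y => gaussianPDFReal_nonneg 0 1 y

lemma hasDerivAt_Q (x : ℝ) : HasDerivAt Q (-gaussianPDFReal 0 1 x) x := by
  have hint := integrable_gaussianPDFReal 0 1
  have hcont : Continuous (gaussianPDFReal 0 1) := by
    unfold gaussianPDFReal
    fun_prop
  have hQ : Q = fun y => Q 0 - ∫ z in (0 : ℝ)..y, gaussianPDFReal 0 1 z := by
    ext y
    rw [← intervalIntegral.integral_Ioi_sub_Ioi' (a := 0) (b := y) hint.integrableOn
      hint.integrableOn, ← Q_eq_integral, ← Q_eq_integral]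
    ring
  rw [hQ]
  exact (intervalIntegral.integral_hasDerivAt_right hint.intervalIntegrable
    (hcont.stronglyMeasurableAtFilter _ _) hcont.continuousAt).const_sub _

@[fun_prop] lemma differentiable_Q : Differentiable ℝ Q :=
  fun x => (hasDerivAt_Q x).differentiableAt

/-- Distance at which the path loss equals `t`, for a path loss exponent `α` and a normalized
shadowing `x`. -/
def lossRadius (α σ m t x : ℝ) : ℝ := Real.exp ((Real.log t + m - σ * x) / α)

/-- The function `Υ_j(t)` of a link type `j` with parameters `α_j = α` and `σ_j = σ`. -/
def ups (α σ m D t : ℝ) : ℝ := (Real.log (D ^ α / t) - m) / σ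

lemma lossRadius_pos (α σ m t x : ℝ) : 0 < lossRadius α σ m t x := Real.exp_pos _

@[fun_prop] lemma measurable_lossRadius (α σ m t : ℝ) : Measurable (lossRadius α σ m t) := by
  unfold lossRadius
  fun_prop

section

variable {α σ m t D : ℝ}

lemma lossRadius_sq (hα : α ≠ 0) (ht : 0 < t) (x : ℝ) :
    lossRadius α σ m t x ^ 2 =
      t ^ (2 / α) * Real.exp (2 * m / α) * Real.exp (-(2 * σ / α * x)) := by
  rw [lossRadius, ← Real.exp_nat_mul, Real.rpow_def_of_pos ht, ← Real.exp_add, ← Real.exp_add]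
  congr 1
  push_cast
  field_simp
  ring

lemma integrable_lossRadius_sq (hα : α ≠ 0) (ht : 0 < t) :
    Integrable (fun x => lossRadius α σ m t x ^ 2) (gaussianReal 0 1) := by
  simp_rw [lossRadius_sq hα ht]
  exact (integrable_exp_neg_mul_gaussianReal _).const_mul _

lemma setIntegral_Ioi_lossRadius_sq (hα : α ≠ 0) (ht : 0 < t) (a : ℝ) :
    ∫ x in Ioi a, lossRadius α σ m t x ^ 2 ∂(gaussianReal 0 1) =
      t ^ (2 / α) * Real.exp (2 * σ ^ 2 / α ^ 2 + 2 * m / α) * Q (2 * σ / α + a) := by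
  have hsquare : (2 * σ / α) ^ 2 / 2 = 2 * σ ^ 2 / α ^ 2 := by ring
  simp_rw [lossRadius_sq hα ht]
  rw [integral_const_mul, setIntegral_Ioi_exp_gaussianReal, hsquare, Real.exp_add]
  ring

lemma integral_lossRadius_sq (hα : α ≠ 0) (ht : 0 < t) :
    ∫ x, lossRadius α σ m t x ^ 2 ∂(gaussianReal 0 1) =
      t ^ (2 / α) * Real.exp (2 * σ ^ 2 / α ^ 2 + 2 * m / α) := by
  have hsquare : (2 * σ / α) ^ 2 / 2 = 2 * σ ^ 2 / α ^ 2 := by ring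
  have hexp := integral_mul_exp_gaussianReal (2 * σ / α) fun _ => 1
  simp only [one_mul, integral_const, smul_eq_mul, mul_one, probReal_univ] at hexp
  simp_rw [lossRadius_sq hα ht]
  rw [integral_const_mul, hexp, hsquare, Real.exp_add]
  ring

lemma le_lossRadius_iff (hα : 0 < α) (hσ : 0 < σ) (hD : 0 < D) (ht : 0 < t) (x : ℝ) :
    D ≤ lossRadius α σ m t x ↔ x ≤ -ups α σ m D t := by
  rw [lossRadius, ← Real.log_le_iff_le_exp hD, le_div_iff₀ hα, ups, ← neg_div, le_div_iff₀ hσ,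
    Real.log_div (by positivity) ht.ne', Real.log_rpow hD]
  constructor <;> intro h <;> linarith

lemma integrable_min_lossRadius_sq (hD : 0 < D) :
    Integrable (fun x => min D (lossRadius α σ m t x) ^ 2) (gaussianReal 0 1) := by
  refine Integrable.of_bound (by fun_prop) (D ^ 2) (ae_of_all _ fun x => ?_)
  rw [Real.norm_of_nonneg (by positivity)]
  exact pow_le_pow_left₀ (le_min hD.le (lossRadius_pos α σ m t x).le) (min_le_left _ _) 2

lemma integral_min_lossRadius_sq (hα : 0 < α) (hσ : 0 < σ) (hD : 0 < D) (ht : 0 < t) :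
    ∫ x, min D (lossRadius α σ m t x) ^ 2 ∂(gaussianReal 0 1) =
      D ^ 2 * Q (ups α σ m D t) + t ^ (2 / α) * Real.exp (2 * σ ^ 2 / α ^ 2 + 2 * m / α) *
        Q (2 * σ ^ 2 / (α * σ) - ups α σ m D t) := by
  have hfar : ∫ x in Iic (-ups α σ m D t), min D (lossRadius α σ m t x) ^ 2 ∂(gaussianReal 0 1) =
      D ^ 2 * Q (ups α σ m D t) := by
    rw [setIntegral_congr_fun measurableSet_Iic fun x hx => by
        rw [min_eq_left ((le_lossRadius_iff hα hσ hD ht x).2 hx)],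
      setIntegral_const, gaussianReal_real_Iic_neg, smul_eq_mul, mul_comm]
  have hnear :
      ∫ x in Ioi (-ups α σ m D t), min D (lossRadius α σ m t x) ^ 2 ∂(gaussianReal 0 1) =
      ∫ x in Ioi (-ups α σ m D t), lossRadius α σ m t x ^ 2 ∂(gaussianReal 0 1) := by
    refine setIntegral_congr_fun measurableSet_Ioi fun x hx => ?_
    rw [min_eq_right (not_le.1 ((le_lossRadius_iff hα hσ hD ht x).not.2 (not_le.2 hx))).le]
  have hratio : 2 * σ ^ 2 / (α * σ) = 2 * σ / α := by field_simp
  rw [← integral_add_compl measurableSet_Iic (integrable_min_lossRadius_sq hD), compl_Iic, hfar,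
    hnear, setIntegral_Ioi_lossRadius_sq hα.ne' ht, hratio, sub_eq_add_neg]

end

/-! ### The intensity of the path losses -/

lemma lintegral_bernoulliMeasure_true_false (q : unitInterval) (f : Bool → ℝ≥0∞) :
    ∫⁻ b, f b ∂(bernoulliMeasure true false q) =
      ENNReal.ofReal q * f true + ENNReal.ofReal (1 - q) * f false := by
  have hdirac (a : ℝ≥0) (b : Bool) : ∫⁻ x, f x ∂(a • Measure.dirac b) = a * f b := by
    rw [lintegral_smul_measure, lintegral_dirac, ENNReal.smul_def, smul_eq_mul]
  rw [bernoulliMeasure_def, lintegral_add_measure, hdirac, hdirac, ← ENNReal.ofReal_coe_nnreal,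
    ← ENNReal.ofReal_coe_nnreal]
  rfl

lemma volume_closedBall_plane {r : ℝ} (hr : 0 ≤ r) :
    volume (Metric.closedBall (0 : Plane) r) = ENNReal.ofReal (Real.pi * r ^ 2) := by
  rw [EuclideanSpace.volume_closedBall_fin_two, mul_comm Real.pi,
    ENNReal.ofReal_mul (by positivity), ENNReal.ofReal_pow hr]

lemma volume_congr_of_ne_zero {A B : Set Plane} (h : ∀ y ≠ 0, y ∈ A ↔ y ∈ B) :
    volume A = volume B :=
  measure_congr ((Measure.ae_ne volume 0).mono fun y hy => propext (h y hy))

section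

variable {F : ℝ → ℝ} {a b : ℝ}

lemma lintegral_Ioc_deriv (hab : a ≤ b) (hF : ∀ x ∈ Icc a b, DifferentiableAt ℝ F x)
    (hF' : ∀ x ∈ Ioc a b, 0 ≤ deriv F x) :
    ∫⁻ x in Ioc a b, ENNReal.ofReal (deriv F x) = ENNReal.ofReal (F b - F a) := by
  have hint : IntegrableOn (deriv F) (Ioc a b) :=
    intervalIntegral.integrableOn_deriv_of_nonneg
      (fun x hx => (hF x hx).continuousAt.continuousWithinAt)
      (fun x hx => (hF x (Ioo_subset_Icc_self hx)).hasDerivAt)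
      (fun x hx => hF' x (Ioo_subset_Ioc_self hx))
  rw [← intervalIntegral.integral_deriv_eq_sub (fun x hx => hF x (uIcc_of_le hab ▸ hx))
      ((intervalIntegrable_iff_integrableOn_Ioc_of_le hab).2 hint),
    intervalIntegral.integral_of_le hab, ofReal_integral_eq_lintegral_ofReal hint]
  exact (ae_restrict_mem measurableSet_Ioc).mono hF'

lemma restrict_Ioi_eq_withDensity_deriv {μ : Measure ℝ} {l : ℝ}
    (hμ : ∀ a b, l ≤ a → a ≤ b → μ (Ioc a b) = ENNReal.ofReal (F b - F a))
    (hF : ∀ x, l ≤ x → DifferentiableAt ℝ F x) (hF' : ∀ x, l < x → 0 ≤ deriv F x) :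
    μ.restrict (Ioi l) =
      (volume.restrict (Ioi l)).withDensity fun t => ENNReal.ofReal (deriv F t) := by
  refine Measure.ext_of_Ioc' _ _ (fun a b _ => ?_) fun a b _ => ?_ <;>
    rw [Measure.restrict_apply measurableSet_Ioc, Ioc_inter_Ioi] <;>
    rcases le_or_gt (max a l) b with h | h
  · exact hμ _ _ (le_max_right a l) h ▸ ENNReal.ofReal_ne_top
  · simp [Ioc_eq_empty_of_le h.le]
  · rw [hμ _ _ (le_max_right a l) h, withDensity_apply _ measurableSet_Ioc,
      Measure.restrict_restrict measurableSet_Ioc, Ioc_inter_Ioi,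
      lintegral_Ioc_deriv h (fun x hx => hF x ((le_max_right a l).trans hx.1))
        fun x hx => hF' x ((le_max_right a l).trans_lt hx.1)]
  · rw [withDensity_apply _ measurableSet_Ioc, Measure.restrict_restrict measurableSet_Ioc,
      Ioc_inter_Ioi]
    simp [Ioc_eq_empty_of_le h.le]

end

namespace Params

variable (p : Params)

lemma sigmaL_pos : 0 < p.sigmaL :=
  mul_pos (mul_pos (by norm_num) p.xiL_pos) (Real.log_pos (by norm_num))

lemma sigmaN_pos : 0 < p.sigmaN :=
  mul_pos (mul_pos (by norm_num) p.xiN_pos) (Real.log_pos (by norm_num))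

/-- The path loss as a function of the position, the LOS indicator and the shadowing; these are
the only marks it depends on. -/
def linkLoss (y : Plane) (b : Bool) (x : ℝ) : ℝ := p.loss y ⟨b, x, 0, 0, 0⟩

lemma loss_eq_linkLoss (y : Plane) (k : Mark) : p.loss y k = p.linkLoss y k.clear k.shadow := rfl

lemma linkLoss_pos (y : Plane) (b : Bool) (x : ℝ) : 0 < p.linkLoss y b x :=
  Real.rpow_pos_of_pos (by norm_num) _

lemma linkLoss_eq (y : Plane) (b : Bool) (x : ℝ) :
    p.linkLoss y b x = if ‖y‖ ≤ p.D ∧ b = true then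
      Real.exp (p.alphaL * Real.log ‖y‖ + p.sigmaL * x - p.m) else
      Real.exp (p.alphaN * Real.log ‖y‖ + p.sigmaN * x - p.m) := by
  have hlog : Real.log 10 ≠ 0 := (Real.log_pos (by norm_num)).ne'
  simp only [linkLoss, loss, lossDB]
  split_ifs
  all_goals
    rw [Real.rpow_def_of_pos (by norm_num)]
    congr 1
    simp only [sigmaL, sigmaN, m, Real.logb]
    field_simp
    ring

attribute [irreducible] linkLoss

lemma linkLoss_le_iff {y : Plane} (hy : y ≠ 0) (b : Bool) (x : ℝ) {t : ℝ} (ht : 0 < t) :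
    p.linkLoss y b x ≤ t ↔ if ‖y‖ ≤ p.D ∧ b = true then
      ‖y‖ ≤ lossRadius p.alphaL p.sigmaL p.m t x else
      ‖y‖ ≤ lossRadius p.alphaN p.sigmaN p.m t x := by
  have hαL := p.alphaL_pos
  have hαN := p.alphaN_pos
  rw [linkLoss_eq]
  split_ifs
  all_goals
    rw [← Real.le_log_iff_exp_le ht, lossRadius, ← Real.log_le_iff_le_exp (norm_pos_iff.2 hy),
      le_div_iff₀ (by assumption)]
    constructor <;> intro h <;> linarith

lemma measurable_linkLoss : Measurable fun z : Plane × Bool × ℝ => p.linkLoss z.1 z.2.1 z.2.2 := by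
  simp_rw [linkLoss_eq]
  refine Measurable.ite ?_ (by fun_prop) (by fun_prop)
  exact (measurableSet_le measurable_fst.norm measurable_const).inter
    ((measurable_fst.comp measurable_snd) (measurableSet_singleton true))

/-- Area of the set of positions at which a BS has a path loss of at most `t`. If the link is LOS
within distance `D`, this is the area of a disc (LOS) and an annulus outside radius `D` (NLOS). -/
def lossArea (t : ℝ) (b : Bool) (x : ℝ) : ℝ :=
  if b = true then
    Real.pi * min p.D (lossRadius p.alphaL p.sigmaL p.m t x) ^ 2 +
      (Real.pi * lossRadius p.alphaN p.sigmaN p.m t x ^ 2 -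
        Real.pi * min p.D (lossRadius p.alphaN p.sigmaN p.m t x) ^ 2)
  else Real.pi * lossRadius p.alphaN p.sigmaN p.m t x ^ 2

lemma pi_mul_min_lossRadius_sq_le (α σ m t x : ℝ) :
    Real.pi * min p.D (lossRadius α σ m t x) ^ 2 ≤ Real.pi * lossRadius α σ m t x ^ 2 := by
  have := (le_min p.D_pos.le (lossRadius_pos α σ m t x).le)
  gcongr
  exact min_le_right _ _

lemma lossArea_nonneg (t : ℝ) (b : Bool) (x : ℝ) : 0 ≤ p.lossArea t b x := by
  unfold lossArea
  split_ifs
  · exact add_nonneg (by positivity) (sub_nonneg.2 (p.pi_mul_min_lossRadius_sq_le _ _ _ _ _))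
  · positivity

@[fun_prop] lemma measurable_lossArea (t : ℝ) (b : Bool) : Measurable (p.lossArea t b) := by
  unfold lossArea
  cases b <;> simp only [Bool.false_eq_true, if_false, if_true] <;> fun_prop

lemma volume_linkLoss_true_le {t : ℝ} (ht : 0 < t) (x : ℝ) :
    volume {y : Plane | p.linkLoss y true x ≤ t} = ENNReal.ofReal (p.lossArea t true x) := by
  set rL := lossRadius p.alphaL p.sigmaL p.m t x
  set rN := lossRadius p.alphaN p.sigmaN p.m t x
  have hL : 0 ≤ min p.D rL := le_min p.D_pos.le (lossRadius_pos _ _ _ _ _).le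
  have hN : 0 ≤ min p.D rN := le_min p.D_pos.le (lossRadius_pos _ _ _ _ _).le
  have hregion : volume {y : Plane | p.linkLoss y true x ≤ t} = volume
      (Metric.closedBall 0 (min p.D rL) ∪
        (Metric.closedBall 0 rN \ Metric.closedBall 0 (min p.D rN)) : Set Plane) := by
    refine volume_congr_of_ne_zero fun y hy => ?_
    rw [mem_ofPred_eq, p.linkLoss_le_iff hy true x ht]
    simp only [mem_union, Set.mem_sdiff, mem_closedBall_zero_iff, le_min_iff, and_true]
    by_cases h : ‖y‖ ≤ p.D <;> simp [h, rL, rN]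
  have hdisjoint : Disjoint (Metric.closedBall (0 : Plane) (min p.D rL))
      (Metric.closedBall 0 rN \ Metric.closedBall 0 (min p.D rN)) := by
    refine disjoint_left.2 fun y hy hy' => ?_
    simp only [Set.mem_sdiff, mem_closedBall_zero_iff, le_min_iff] at hy hy'
    tauto
  rw [hregion, measure_union hdisjoint
      (Metric.isClosed_closedBall.measurableSet.diff Metric.isClosed_closedBall.measurableSet),
    measure_sdiff (Metric.closedBall_subset_closedBall (min_le_right _ _))
      Metric.isClosed_closedBall.measurableSet.nullMeasurableSet measure_closedBall_lt_top.ne,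
    volume_closedBall_plane hL, volume_closedBall_plane (lossRadius_pos _ _ _ _ _).le,
    volume_closedBall_plane hN, ← ENNReal.ofReal_sub _ (by positivity),
    ← ENNReal.ofReal_add (by positivity)
      (sub_nonneg.2 (p.pi_mul_min_lossRadius_sq_le _ _ _ _ _)), lossArea, if_pos rfl]

lemma volume_linkLoss_false_le {t : ℝ} (ht : 0 < t) (x : ℝ) :
    volume {y : Plane | p.linkLoss y false x ≤ t} = ENNReal.ofReal (p.lossArea t false x) := by
  have hregion : volume {y : Plane | p.linkLoss y false x ≤ t} = volume
      (Metric.closedBall (0 : Plane) (lossRadius p.alphaN p.sigmaN p.m t x)) := by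
    refine volume_congr_of_ne_zero fun y hy => ?_
    rw [mem_ofPred_eq, p.linkLoss_le_iff hy false x ht]
    simp
  rw [hregion, volume_closedBall_plane (lossRadius_pos _ _ _ _ _).le, lossArea, if_neg (by simp)]

/-- Intensity measure of the point process of path losses, for a unit density of BSs. -/
def lossIntensity : Measure ℝ :=
  ((volume : Measure Plane).prod
    ((bernoulliMeasure true false p.pLOS).prod (gaussianReal 0 1))).map
    fun z => p.linkLoss z.1 z.2.1 z.2.2

lemma M_eq {t : ℝ} (ht : 0 < t) :
    p.M t = p.pLOS * ∫ x, p.lossArea t true x ∂(gaussianReal 0 1) +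
      (1 - p.pLOS) * ∫ x, p.lossArea t false x ∂(gaussianReal 0 1) := by
  have hminL := (integrable_min_lossRadius_sq (α := p.alphaL) (σ := p.sigmaL) (m := p.m) (t := t)
    p.D_pos).const_mul Real.pi
  have hminN := (integrable_min_lossRadius_sq (α := p.alphaN) (σ := p.sigmaN) (m := p.m) (t := t)
    p.D_pos).const_mul Real.pi
  have hN := (integrable_lossRadius_sq (σ := p.sigmaN) (m := p.m) p.alphaN_pos.ne' ht).const_mul
    Real.pi
  simp only [lossArea, if_true, Bool.false_eq_true, if_false]
  rw [integral_add hminL (hN.sub' hminN), integral_sub hN hminN, integral_const_mul,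
    integral_const_mul, integral_const_mul,
    integral_min_lossRadius_sq p.alphaL_pos p.sigmaL_pos p.D_pos ht,
    integral_min_lossRadius_sq p.alphaN_pos p.sigmaN_pos p.D_pos ht,
    integral_lossRadius_sq p.alphaN_pos.ne' ht]
  simp only [M, ML, MN, upsL, upsN, ups]
  ring

lemma integrable_lossArea {t : ℝ} (ht : 0 < t) (b : Bool) :
    Integrable (p.lossArea t b) (gaussianReal 0 1) := by
  have hN := (integrable_lossRadius_sq (σ := p.sigmaN) (m := p.m) p.alphaN_pos.ne' ht).const_mul
    Real.pi
  cases b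
  · exact hN
  · exact ((integrable_min_lossRadius_sq p.D_pos).const_mul _).add
      (hN.sub ((integrable_min_lossRadius_sq p.D_pos).const_mul _))

lemma integral_lossArea_nonneg (t : ℝ) (b : Bool) :
    0 ≤ ∫ x, p.lossArea t b x ∂(gaussianReal 0 1) :=
  integral_nonneg (p.lossArea_nonneg t b)

lemma one_sub_pLOS_nonneg : 0 ≤ 1 - (p.pLOS : ℝ) := sub_nonneg.2 p.pLOS.2.2

lemma M_nonneg {t : ℝ} (ht : 0 < t) : 0 ≤ p.M t := by
  rw [p.M_eq ht]
  exact add_nonneg (mul_nonneg p.pLOS.2.1 (p.integral_lossArea_nonneg t _))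
    (mul_nonneg p.one_sub_pLOS_nonneg (p.integral_lossArea_nonneg t _))

lemma lossIntensity_Iic {t : ℝ} (ht : 0 < t) :
    p.lossIntensity (Iic t) = ENNReal.ofReal (p.M t) := by
  have harea (z : Bool × ℝ) : volume ((fun y : Plane => (y, z)) ⁻¹'
      ((fun z : Plane × Bool × ℝ => p.linkLoss z.1 z.2.1 z.2.2) ⁻¹' Iic t)) =
      ENNReal.ofReal (p.lossArea t z.1 z.2) := by
    obtain ⟨_ | _, x⟩ := z
    exacts [p.volume_linkLoss_false_le ht x, p.volume_linkLoss_true_le ht x]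
  have hmeas : Measurable fun z : Bool × ℝ => ENNReal.ofReal (p.lossArea t z.1 z.2) :=
    measurable_from_prod_countable_right fun b => (p.measurable_lossArea t b).ennreal_ofReal
  have hmean (b : Bool) : ∫⁻ x, ENNReal.ofReal (p.lossArea t b x) ∂(gaussianReal 0 1) =
      ENNReal.ofReal (∫ x, p.lossArea t b x ∂(gaussianReal 0 1)) :=
    (ofReal_integral_eq_lintegral_ofReal (p.integrable_lossArea ht b)
      (ae_of_all _ (p.lossArea_nonneg t b))).symm
  rw [lossIntensity, Measure.map_apply p.measurable_linkLoss measurableSet_Iic,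
    Measure.prod_apply_symm (p.measurable_linkLoss measurableSet_Iic)]
  simp_rw [harea]
  rw [lintegral_prod _ hmeas.aemeasurable, lintegral_bernoulliMeasure_true_false, hmean, hmean,
    ← ENNReal.ofReal_mul p.pLOS.2.1, ← ENNReal.ofReal_mul p.one_sub_pLOS_nonneg,
    ← ENNReal.ofReal_add (mul_nonneg p.pLOS.2.1 (p.integral_lossArea_nonneg t _))
      (mul_nonneg p.one_sub_pLOS_nonneg (p.integral_lossArea_nonneg t _)), ← p.M_eq ht]

lemma lossIntensity_Ioc {a b : ℝ} (ha : 0 < a) (hab : a ≤ b) :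
    p.lossIntensity (Ioc a b) = ENNReal.ofReal (p.M b - p.M a) := by
  rw [← Iic_sdiff_Iic, measure_sdiff (Iic_subset_Iic.2 hab) measurableSet_Iic.nullMeasurableSet
      (p.lossIntensity_Iic ha ▸ ENNReal.ofReal_ne_top),
    p.lossIntensity_Iic ha, p.lossIntensity_Iic (ha.trans_le hab),
    ENNReal.ofReal_sub _ (p.M_nonneg ha)]

lemma monotoneOn_M : MonotoneOn p.M (Ioi 0) := by
  intro a ha b hb hab
  rw [← ENNReal.ofReal_le_ofReal_iff (p.M_nonneg hb), ← p.lossIntensity_Iic ha,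
    ← p.lossIntensity_Iic hb]
  exact measure_mono (Iic_subset_Iic.2 hab)

lemma differentiableAt_M {t : ℝ} (ht : 0 < t) : DifferentiableAt ℝ p.M t := by
  have hquot (α : ℝ) : p.D ^ α / t ≠ 0 := (div_pos (Real.rpow_pos_of_pos p.D_pos α) ht).ne'
  have ht' : t ≠ 0 := ht.ne'
  have hlog (α : ℝ) : DifferentiableAt ℝ (fun t => Real.log (p.D ^ α / t)) t :=
    ((differentiableAt_const _).div differentiableAt_id ht').log (hquot α)
  have hL : DifferentiableAt ℝ p.upsL t := ((hlog _).sub_const _).div_const _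
  have hN : DifferentiableAt ℝ p.upsN t := ((hlog _).sub_const _).div_const _
  have (α : ℝ) : DifferentiableAt ℝ (fun t : ℝ => t ^ α) t :=
    Real.differentiableAt_rpow_const_of_ne α ht'
  change DifferentiableAt ℝ (fun t => p.ML t + p.MN t) t
  unfold ML MN
  fun_prop

lemma deriv_M_nonneg {t : ℝ} (ht : 0 < t) : 0 ≤ deriv p.M t := by
  rw [← derivWithin_of_isOpen isOpen_Ioi ht]
  exact p.monotoneOn_M.derivWithin_nonneg

lemma restrict_lossIntensity {l : ℝ} (hl : 0 < l) :
    p.lossIntensity.restrict (Ioi l) =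
      (volume.restrict (Ioi l)).withDensity fun t => ENNReal.ofReal (deriv p.M t) :=
  restrict_Ioi_eq_withDensity_deriv
    (fun _ _ ha hab => p.lossIntensity_Ioc (hl.trans_le ha) hab)
    (fun _ hx => p.differentiableAt_M (hl.trans_le hx)) fun _ hx => p.deriv_M_nonneg (hl.trans hx)

end Params

/-! ### Averaging over the marks -/

section

variable {N : ℕ}

lemma sum_Ico_angleProb (hN : 1 ≤ N) :
    ∑ j ∈ Finset.Ico 1 N, (Real.arcsin (-1 + (2 * j + 1) / N) -
        Real.arcsin (-1 + (2 * j - 1) / N)) / Real.pi =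
      (Real.arcsin (-1 + (2 * N - 1) / N) - Real.arcsin (-1 + 1 / N)) / Real.pi := by
  have htelescope := Finset.sum_Ico_sub (fun i : ℕ => Real.arcsin (-1 + (2 * i - 1) / N)) hN
  have hstep (j : ℕ) : (2 * ((j + 1 : ℕ) : ℝ) - 1) / N = (2 * j + 1) / N := by
    push_cast
    ring
  simp only [hstep, Nat.cast_one, mul_one] at htelescope
  rw [← Finset.sum_div, htelescope]
  norm_num

lemma angleProb_nonneg (hN : 1 ≤ N) (i : ℕ) : 0 ≤ angleProb N i := by
  simp only [angleProb]
  split_ifs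
  · refine div_nonneg (sub_nonneg.2 (Real.monotone_arcsin ?_)) Real.pi_pos.le
    gcongr
    linarith
  · rw [sum_Ico_angleProb hN, sub_nonneg, div_le_one Real.pi_pos]
    linarith [Real.arcsin_le_pi_div_two (-1 + (2 * N - 1) / N),
      Real.neg_pi_div_two_le_arcsin (-1 + 1 / N)]

lemma sum_angleProb (hN : 1 ≤ N) : ∑ i ∈ Finset.Icc 1 N, angleProb N i = 1 := by
  have hlt : ∀ j ∈ Finset.Ico 1 N, angleProb N j = (Real.arcsin (-1 + (2 * j + 1) / N) -
      Real.arcsin (-1 + (2 * j - 1) / N)) / Real.pi := fun j hj => by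
    simp [angleProb, (Finset.mem_Ico.1 hj).2]
  rw [← Finset.Ico_insert_right hN, Finset.sum_insert (by simp), Finset.sum_congr rfl hlt]
  simp [angleProb]

lemma angleProb_le_one (hN : 1 ≤ N) {i : ℕ} (hi : i ∈ Finset.Icc 1 N) : angleProb N i ≤ 1 := by
  rw [← sum_angleProb hN]
  exact Finset.single_le_sum (fun j _ => angleProb_nonneg hN j) hi

end

lemma measurable_complex_mk : Measurable fun z : ℝ × ℝ => (⟨z.1, z.2⟩ : ℂ) :=
  Complex.measurableEquivRealProd.symm.measurable

instance : IsProbabilityMeasure stdComplexNormal :=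
  Measure.isProbabilityMeasure_map measurable_complex_mk.aemeasurable

section

variable {c : ℝ}

lemma integral_exp_neg_mul_sq_gaussianReal (hc : -1 < c) :
    ∫ x, Real.exp (-(c * x ^ 2)) ∂(gaussianReal 0 (1 / 2)) = √(1 / (1 + c)) := by
  have hdensity (x : ℝ) : gaussianPDFReal 0 (1 / 2) x • Real.exp (-(c * x ^ 2)) =
      (√Real.pi)⁻¹ * Real.exp (-(1 + c) * x ^ 2) := by
    have hvar : 2 * Real.pi * ((1 / 2 : ℝ≥0) : ℝ) = Real.pi := by
      push_cast
      ring
    rw [gaussianPDFReal, hvar, smul_eq_mul, mul_assoc, ← Real.exp_add]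
    push_cast
    ring_nf
  have hc' : 0 < 1 + c := by linarith
  rw [integral_gaussianReal_eq_integral_smul (by norm_num)]
  simp_rw [hdensity]
  rw [integral_const_mul, integral_gaussian, Real.sqrt_div' _ hc'.le, Real.sqrt_div' _ hc'.le,
    Real.sqrt_one, mul_div_assoc', inv_mul_cancel₀ (Real.sqrt_pos.2 Real.pi_pos).ne']

lemma lintegral_nexp_mul_sq_gaussianReal (hc : 0 ≤ c) :
    ∫⁻ x, nexp (ENNReal.ofReal (c * x ^ 2)) ∂(gaussianReal 0 (1 / 2)) =
      ENNReal.ofReal (√(1 / (1 + c))) := by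
  have hint : Integrable (fun x : ℝ => Real.exp (-(c * x ^ 2))) (gaussianReal 0 (1 / 2)) :=
    Integrable.of_bound (by fun_prop) 1 (ae_of_all _ fun x => by
      rw [Real.norm_of_nonneg (Real.exp_pos _).le, Real.exp_le_one_iff, neg_nonpos]
      positivity)
  rw [← integral_exp_neg_mul_sq_gaussianReal (by linarith),
    ofReal_integral_eq_lintegral_ofReal hint (ae_of_all _ fun x => (Real.exp_pos _).le)]
  exact lintegral_congr fun x => nexp_ofReal (by positivity)

lemma lintegral_nexp_mul_sq_stdComplexNormal (hc : 0 ≤ c) :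
    ∫⁻ z, nexp (ENNReal.ofReal (c * ‖z‖ ^ 2)) ∂stdComplexNormal =
      ENNReal.ofReal (1 / (1 + c)) := by
  have hprod (w : ℝ × ℝ) : nexp (ENNReal.ofReal (c * ‖(⟨w.1, w.2⟩ : ℂ)‖ ^ 2)) =
      nexp (ENNReal.ofReal (c * w.1 ^ 2)) * nexp (ENNReal.ofReal (c * w.2 ^ 2)) := by
    rw [← nexp_add, ← ENNReal.ofReal_add (by positivity) (by positivity), Complex.sq_norm,
      Complex.normSq_mk]
    ring_nf
  have hmeas : Measurable fun x : ℝ => nexp (ENNReal.ofReal (c * x ^ 2)) := by fun_prop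
  rw [stdComplexNormal, lintegral_map (by fun_prop) measurable_complex_mk]
  simp_rw [hprod]
  rw [lintegral_prod_mul hmeas.aemeasurable hmeas.aemeasurable,
    lintegral_nexp_mul_sq_gaussianReal hc, ← ENNReal.ofReal_mul (by positivity),
    Real.mul_self_sqrt (by positivity)]

lemma lintegral_one_sub_nexp_mul_sq_stdComplexNormal (hc : 0 ≤ c) :
    ∫⁻ z, (1 - nexp (ENNReal.ofReal (c * ‖z‖ ^ 2))) ∂stdComplexNormal =
      ENNReal.ofReal (c / (1 + c)) := by
  have hcompl : c / (1 + c) = 1 - 1 / (1 + c) := by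
    field_simp
    ring
  rw [lintegral_sub (by fun_prop) (lintegral_nexp_mul_sq_stdComplexNormal hc ▸
      ENNReal.ofReal_ne_top) (ae_of_all _ fun z => nexp_le_one _),
    lintegral_nexp_mul_sq_stdComplexNormal hc, lintegral_one, measure_univ, hcompl,
    ENNReal.ofReal_sub _ (by positivity), ENNReal.ofReal_one]

end

namespace Params

variable (p : Params)

lemma G_pos : 0 < p.G :=
  mul_pos (mul_pos p.power_pos (Nat.cast_pos.2 p.NBS_pos)) (Nat.cast_pos.2 p.NUE_pos)

lemma alignProb_nonneg : 0 ≤ p.alignProb := Finset.sum_nonneg fun _ _ => sq_nonneg _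

lemma alignProb_le_one : p.alignProb ≤ 1 := by
  rw [← sum_angleProb p.NUE_pos]
  exact Finset.sum_le_sum fun i hi =>
    pow_le_of_le_one (angleProb_nonneg p.NUE_pos i) (angleProb_le_one p.NUE_pos hi) two_ne_zero

lemma collisionProb_nonneg (n k : ℕ) : 0 ≤ p.collisionProb n k :=
  mul_nonneg (Nat.cast_nonneg _) (Finset.sum_nonneg fun i hi =>
    mul_nonneg (pow_nonneg (angleProb_nonneg p.NBS_pos i) _)
      (pow_nonneg (sub_nonneg.2 (angleProb_le_one p.NBS_pos hi)) _))

lemma beamGain_nonneg {n k : ℕ} (hk : k ≤ n) : 0 ≤ p.beamGain n k :=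
  add_nonneg (Nat.cast_nonneg _)
    (mul_nonneg (sub_nonneg.2 (Nat.cast_le.2 hk)) (sq_nonneg _))

lemma beamGain_zero_zero : p.beamGain 0 0 = 0 := by simp [beamGain]

lemma lintegral_loadGainLaw (f : ℕ × ℝ → ℝ≥0∞) :
    ∫⁻ q, f q ∂p.loadGainLaw = ∑ n ∈ Finset.range (p.UM + 1), ENNReal.ofReal (p.loadPMF n) *
      ∑ k ∈ Finset.range (n + 1), ENNReal.ofReal (p.collisionProb n k) *
        (ENNReal.ofReal p.alignProb * f (n, p.beamGain n k) +
          ENNReal.ofReal (1 - p.alignProb) * f (n, p.rhoUE ^ 2 * p.beamGain n k)) := by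
  have ha := p.alignProb_nonneg
  have ha' := sub_nonneg.2 p.alignProb_le_one
  rw [loadGainLaw, lintegral_finsetSum_measure]
  refine Finset.sum_congr rfl fun n _ => ?_
  rw [lintegral_finsetSum_measure, Finset.mul_sum]
  refine Finset.sum_congr rfl fun k _ => ?_
  have hc := p.collisionProb_nonneg n k
  rw [lintegral_add_measure, lintegral_smul_measure, lintegral_smul_measure, lintegral_dirac,
    lintegral_dirac, ENNReal.ofReal_mul' (mul_nonneg ha hc),
    ENNReal.ofReal_mul' (mul_nonneg ha' hc), ENNReal.ofReal_mul ha, ENNReal.ofReal_mul ha',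
    smul_eq_mul, smul_eq_mul]
  ring

lemma lintegral_loadGainLaw_lt_top {f : ℕ × ℝ → ℝ≥0∞} (hf : ∀ q, f q < ∞) :
    ∫⁻ q, f q ∂p.loadGainLaw < ∞ := by
  have hterm (x : ℝ) (q : ℕ × ℝ) : ENNReal.ofReal x * f q < ∞ :=
    ENNReal.mul_lt_top ENNReal.ofReal_lt_top (hf q)
  rw [p.lintegral_loadGainLaw]
  exact ENNReal.sum_lt_top.2 fun n _ => ENNReal.mul_lt_top ENNReal.ofReal_lt_top <|
    ENNReal.sum_lt_top.2 fun k _ => ENNReal.mul_lt_top ENNReal.ofReal_lt_top <|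
      ENNReal.add_lt_top.2 ⟨hterm _ _, hterm _ _⟩

instance : IsFiniteMeasure p.loadGainLaw where
  measure_univ_lt_top := by
    rw [← lintegral_one]
    exact p.lintegral_loadGainLaw_lt_top fun _ => ENNReal.one_lt_top

lemma ae_loadGainLaw : ∀ᵐ q ∂p.loadGainLaw, 0 ≤ q.2 ∧ (q.1 = 0 → q.2 = 0) := by
  have hgain {n k : ℕ} (hk : k ∈ Finset.range (n + 1)) :
      0 ≤ p.beamGain n k ∧ (n = 0 → p.beamGain n k = 0) := by
    have hkn : k ≤ n := Nat.lt_succ_iff.1 (Finset.mem_range.1 hk)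
    refine ⟨p.beamGain_nonneg hkn, ?_⟩
    rintro rfl
    rw [Nat.le_zero.1 hkn, beamGain_zero_zero]
  simp only [loadGainLaw, ae_finsetSum_measure_iff, ae_add_measure_iff]
  refine fun n _ k hk => ⟨Measure.ae_smul_measure ?_ _, Measure.ae_smul_measure ?_ _⟩ <;>
    rw [ae_dirac_eq, eventually_pure]
  · exact hgain hk
  · exact ⟨mul_nonneg (sq_nonneg _) (hgain hk).1, fun h => mul_eq_zero_of_right _ ((hgain hk).2 h)⟩

lemma measurable_kernel (s v : ℝ) (n : ℕ) : Measurable (p.kernel s v n) := by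
  unfold kernel
  split_ifs <;> fun_prop

lemma kernel_eq {s t v : ℝ} {n : ℕ} (hs : 0 ≤ s) (ht : 0 < t) (hv : 0 ≤ v)
    (hn : n = 0 → v = 0) :
    p.kernel s v n t = s * p.G * t⁻¹ * v / n / (1 + s * p.G * t⁻¹ * v / n) := by
  have hG := p.G_pos
  rcases hs.eq_or_lt with rfl | hs
  · simp [kernel]
  rcases hv.eq_or_lt with rfl | hv
  · simp [kernel]
  have hn' : (0 : ℝ) < n := Nat.cast_pos.2 (Nat.pos_of_ne_zero fun h => hv.ne' (hn h))
  rw [kernel, if_neg (by positivity)]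
  field_simp
  ring

lemma lossIntegral_eq {l : ℝ} (hl : 0 < l) (s v : ℝ) (n : ℕ) :
    p.lossIntegral s l v n =
      ∫⁻ t in Ioi l, ENNReal.ofReal (p.kernel s v n t) ∂p.lossIntensity := by
  rw [p.restrict_lossIntensity hl, lintegral_withDensity_eq_lintegral_mul _
    (measurable_deriv _).ennreal_ofReal (p.measurable_kernel s v n).ennreal_ofReal, lossIntegral,
    ← setLIntegral_congr Ioi_ae_eq_Ici]
  exact setLIntegral_congr_fun measurableSet_Ioi fun t ht =>
    ENNReal.ofReal_mul (p.deriv_M_nonneg (hl.trans ht))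

lemma exponent_eq (s l : ℝ) :
    p.exponent s l = ∫⁻ q, p.lossIntegral s l q.2 q.1 ∂p.loadGainLaw :=
  (p.lintegral_loadGainLaw fun q => p.lossIntegral s l q.2 q.1).symm

/-- The path loss together with the marks on which the path loss does not depend. -/
def lossMark (w : Plane × Bool × ℝ × ℂ × (ℕ × ℝ)) : ℝ × ℂ × (ℕ × ℝ) :=
  (p.linkLoss w.1 w.2.1 w.2.2.1, w.2.2.2)

instance : SFinite p.lossIntensity := by
  unfold lossIntensity
  infer_instance

instance : IsFiniteMeasure p.markLaw := by
  unfold markLaw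
  infer_instance

lemma measurePreserving_lossMark :
    MeasurePreserving p.lossMark ((volume : Measure Plane).prod p.markLaw)
      (p.lossIntensity.prod (stdComplexNormal.prod p.loadGainLaw)) := by
  have hloss : MeasurePreserving (fun z : Plane × Bool × ℝ => p.linkLoss z.1 z.2.1 z.2.2)
      (volume.prod ((bernoulliMeasure true false p.pLOS).prod (gaussianReal 0 1)))
      p.lossIntensity := ⟨p.measurable_linkLoss, rfl⟩
  exact (hloss.prod (.id (stdComplexNormal.prod p.loadGainLaw))).comp
    (((measurePreserving_prodAssoc _ _ _).symm).comp
      ((MeasurePreserving.id volume).prod (measurePreserving_prodAssoc _ _ _).symm))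

/-- Path loss `t` of a BS, and its interference multiplied by `s`, in terms of `t`, of the fading
`z` and of the load and gain `(n, v)`. -/
def lossInterference (s : ℝ) (w : ℝ × ℂ × (ℕ × ℝ)) : ℝ × ℝ≥0∞ :=
  (w.1, ENNReal.ofReal s * ENNReal.ofReal (p.G * ‖w.2.1‖ ^ 2 * w.1⁻¹ * w.2.2.2 / w.2.2.1))

@[fun_prop] lemma measurable_lossInterference (s : ℝ) : Measurable (p.lossInterference s) := by
  have : Measurable fun w : ℝ × ℂ × (ℕ × ℝ) => (w.2.2.1 : ℝ) :=
    measurable_from_nat.comp (by fun_prop)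
  unfold lossInterference
  fun_prop

lemma lintegral_one_sub_nexp_lossInterference {s t : ℝ} {q : ℕ × ℝ} (hs : 0 ≤ s) (ht : 0 < t)
    (hv : 0 ≤ q.2) (hn : q.1 = 0 → q.2 = 0) :
    ∫⁻ z, (1 - nexp (p.lossInterference s (t, z, q)).2) ∂stdComplexNormal =
      ENNReal.ofReal (p.kernel s q.2 q.1 t) := by
  have hG := p.G_pos
  rw [p.kernel_eq hs ht hv hn, ← lintegral_one_sub_nexp_mul_sq_stdComplexNormal (by positivity)]
  refine lintegral_congr fun z => ?_
  rw [lossInterference, ← ENNReal.ofReal_mul hs]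
  ring_nf

/-- Intensity measure of the pairs of path loss and interference multiplied by `s`. -/
def lossInterferenceIntensity (s : ℝ) : Measure (ℝ × ℝ≥0∞) :=
  (ENNReal.ofReal p.lamBS •
    p.lossIntensity.prod (stdComplexNormal.prod p.loadGainLaw)).map (p.lossInterference s)

lemma laplaceAbove_lossInterferenceIntensity {s l : ℝ} (hs : 0 ≤ s) (hl : 0 < l) :
    laplaceAbove (p.lossInterferenceIntensity s) l =
      nexp (ENNReal.ofReal p.lamBS * p.exponent s l) := by
  have hset : MeasurableSet {w : ℝ × ℝ≥0∞ | l < w.1} := measurableSet_lt (by fun_prop) (by fun_prop)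
  have hpre : p.lossInterference s ⁻¹' {w | l < w.1} = Ioi l ×ˢ univ := by
    ext w
    simp [lossInterference]
  have hmeas : Measurable fun w => 1 - nexp (p.lossInterference s w).2 := by fun_prop
  rw [laplaceAbove, lossInterferenceIntensity, setLIntegral_map hset (by fun_prop) (by fun_prop),
    hpre, Measure.restrict_smul, lintegral_smul_measure, smul_eq_mul, ← Measure.prod_restrict,
    Measure.restrict_univ, lintegral_prod_symm _ hmeas.aemeasurable,
    lintegral_prod_symm _ hmeas.lintegral_prod_left'.aemeasurable, exponent_eq]
  congr 2
  refine lintegral_congr_ae (p.ae_loadGainLaw.mono fun q hq => ?_)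
  dsimp only
  rw [p.lossIntegral_eq hl, lintegral_lintegral_swap]
  · refine setLIntegral_congr_fun measurableSet_Ioi fun t ht => ?_
    exact p.lintegral_one_sub_nexp_lossInterference hs (hl.trans ht) hq.1 hq.2
  · exact (hmeas.comp (f := fun w : ℂ × ℝ => (w.2, w.1, q)) (by fun_prop)).aemeasurable

end Params

/-! ### Finiteness -/

lemma setLIntegral_Ioi_inv_lt_top {μ : Measure ℝ} {l A B c : ℝ} (hl : 0 < l) (hc : c < 1)
    (hμ : ∀ u, l < u → μ (Ioo l u) ≤ ENNReal.ofReal (A + B * u ^ c)) :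
    ∫⁻ t in Ioi l, ENNReal.ofReal t⁻¹ ∂μ < ∞ := by
  have hlayer : ∀ x ∈ Ioi (0 : ℝ), (μ.restrict (Ioi l)) {t | x < t⁻¹} ≤
      (Ioo 0 l⁻¹).indicator (fun x => ENNReal.ofReal (A + B * x ^ (-c))) x := fun x hx => by
    have hsub : {t | x < t⁻¹} ∩ Ioi l ⊆ Ioo l x⁻¹ := fun t ht =>
      ⟨ht.2, (lt_inv_comm₀ hx (hl.trans ht.2)).1 ht.1⟩
    rw [Measure.restrict_apply (measurableSet_lt (by fun_prop) (by fun_prop))]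
    refine (measure_mono hsub).trans ?_
    rcases lt_or_ge x l⁻¹ with h | h
    · rw [indicator_of_mem (mem_Ioo.2 ⟨hx, h⟩), Real.rpow_neg (le_of_lt hx),
        ← Real.inv_rpow (le_of_lt hx)]
      exact hμ _ ((lt_inv_comm₀ hx hl).1 h)
    · rw [Ioo_eq_empty_of_le (inv_le_of_inv_le₀ hl h), measure_empty]
      exact zero_le
  have hint : IntegrableOn (fun x : ℝ => A + B * x ^ (-c)) (Ioo 0 l⁻¹) :=
    (integrable_const A).add (((intervalIntegral.integrableOn_Ioo_rpow_iff (inv_pos.2 hl)).2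
      (neg_lt_neg hc)).const_mul B)
  calc ∫⁻ t in Ioi l, ENNReal.ofReal t⁻¹ ∂μ
      = ∫⁻ x in Ioi 0, (μ.restrict (Ioi l)) {t | x < t⁻¹} :=
        lintegral_eq_lintegral_meas_lt _ ((ae_restrict_mem measurableSet_Ioi).mono fun t ht =>
          inv_nonneg.2 (hl.trans ht).le) (by fun_prop)
    _ ≤ ∫⁻ x in Ioi 0, (Ioo 0 l⁻¹).indicator (fun x => ENNReal.ofReal (A + B * x ^ (-c))) x :=
        setLIntegral_mono' measurableSet_Ioi hlayer
    _ ≤ ∫⁻ x in Ioo 0 l⁻¹, ENNReal.ofReal (A + B * x ^ (-c)) := by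
        rw [← lintegral_indicator measurableSet_Ioo]
        exact setLIntegral_le_lintegral _ _
    _ < ∞ := hint.lintegral_lt_top

namespace Params

variable (p : Params)

lemma lossArea_le (t : ℝ) (b : Bool) (x : ℝ) :
    p.lossArea t b x ≤
      Real.pi * p.D ^ 2 + Real.pi * lossRadius p.alphaN p.sigmaN p.m t x ^ 2 := by
  have hL : Real.pi * min p.D (lossRadius p.alphaL p.sigmaL p.m t x) ^ 2 ≤ Real.pi * p.D ^ 2 := by
    have := le_min p.D_pos.le (lossRadius_pos p.alphaL p.sigmaL p.m t x).le
    gcongr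
    exact min_le_left _ _
  unfold lossArea
  split_ifs
  · exact add_le_add hL (sub_le_self _ (by positivity))
  · exact le_add_of_nonneg_left (by positivity)

lemma M_le {t : ℝ} (ht : 0 < t) : p.M t ≤ Real.pi * p.D ^ 2 + Real.pi *
    Real.exp (2 * p.sigmaN ^ 2 / p.alphaN ^ 2 + 2 * p.m / p.alphaN) * t ^ (2 / p.alphaN) := by
  have hN := (integrable_lossRadius_sq (σ := p.sigmaN) (m := p.m) p.alphaN_pos.ne' ht).const_mul
    Real.pi
  have hmean (b : Bool) : ∫ x, p.lossArea t b x ∂(gaussianReal 0 1) ≤ Real.pi * p.D ^ 2 +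
      Real.pi * (t ^ (2 / p.alphaN) *
        Real.exp (2 * p.sigmaN ^ 2 / p.alphaN ^ 2 + 2 * p.m / p.alphaN)) := by
    refine (integral_mono (p.integrable_lossArea ht b) ((integrable_const _).add hN)
      (p.lossArea_le t b)).trans_eq ?_
    rw [integral_add' (integrable_const _) hN, integral_const, probReal_univ, one_smul,
      integral_const_mul, integral_lossRadius_sq p.alphaN_pos.ne' ht]
  rw [p.M_eq ht]
  linarith [mul_le_mul_of_nonneg_left (hmean true) p.pLOS.2.1,
    mul_le_mul_of_nonneg_left (hmean false) p.one_sub_pLOS_nonneg]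

lemma lintegral_inv_lossIntensity_lt_top (hα : 2 < p.alphaN) {l : ℝ} (hl : 0 < l) :
    ∫⁻ t in Ioi l, ENNReal.ofReal t⁻¹ ∂p.lossIntensity < ∞ := by
  refine setLIntegral_Ioi_inv_lt_top (A := Real.pi * p.D ^ 2) (B := Real.pi *
    Real.exp (2 * p.sigmaN ^ 2 / p.alphaN ^ 2 + 2 * p.m / p.alphaN)) hl
    ((div_lt_one p.alphaN_pos).2 hα) fun u hu => ?_
  calc p.lossIntensity (Ioo l u) ≤ p.lossIntensity (Iic u) :=
        measure_mono (Ioo_subset_Ioc_self.trans Ioc_subset_Iic_self)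
    _ = ENNReal.ofReal (p.M u) := p.lossIntensity_Iic (hl.trans hu)
    _ ≤ _ := ENNReal.ofReal_le_ofReal (p.M_le (hl.trans hu))

lemma kernel_le {s t v : ℝ} {n : ℕ} (hs : 0 ≤ s) (ht : 0 < t) (hv : 0 ≤ v)
    (hn : n = 0 → v = 0) : p.kernel s v n t ≤ s * (p.G * v / n) * t⁻¹ := by
  have hG := p.G_pos
  rw [p.kernel_eq hs ht hv hn]
  refine (div_le_self (by positivity) (le_add_of_nonneg_right (by positivity))).trans_eq ?_
  ring

lemma lossIntegral_le {s l v : ℝ} {n : ℕ} (hs : 0 ≤ s) (hl : 0 < l) (hv : 0 ≤ v)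
    (hn : n = 0 → v = 0) :
    p.lossIntegral s l v n ≤ ENNReal.ofReal s * (ENNReal.ofReal (p.G * v / n) *
      ∫⁻ t in Ioi l, ENNReal.ofReal t⁻¹ ∂p.lossIntensity) := by
  have hG := p.G_pos
  rw [p.lossIntegral_eq hl, ← mul_assoc, ← ENNReal.ofReal_mul hs,
    ← lintegral_const_mul' _ _ ENNReal.ofReal_ne_top]
  refine setLIntegral_mono' measurableSet_Ioi fun t ht => ?_
  rw [← ENNReal.ofReal_mul (by positivity)]
  exact ENNReal.ofReal_le_ofReal (p.kernel_le hs (hl.trans ht) hv hn)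

lemma exists_exponent_le (hα : 2 < p.alphaN) {l : ℝ} (hl : 0 < l) :
    ∃ C < ∞, ∀ s, 0 ≤ s → p.exponent s l ≤ ENNReal.ofReal s * C := by
  refine ⟨∫⁻ q, ENNReal.ofReal (p.G * q.2 / q.1) *
    ∫⁻ t in Ioi l, ENNReal.ofReal t⁻¹ ∂p.lossIntensity ∂p.loadGainLaw,
    p.lintegral_loadGainLaw_lt_top fun q => ENNReal.mul_lt_top ENNReal.ofReal_lt_top
      (p.lintegral_inv_lossIntensity_lt_top hα hl), fun s hs => ?_⟩
  rw [exponent_eq, ← lintegral_const_mul' _ _ ENNReal.ofReal_ne_top]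
  exact lintegral_mono_ae (p.ae_loadGainLaw.mono fun q hq => p.lossIntegral_le hs hl hq.1 hq.2)

end Params

/-! ### The network -/

section

variable {Ω E F : Type*} [MeasurableSpace Ω] [MeasurableSpace E] [MeasurableSpace F]
  {P : Measure Ω}

lemma setLIntegral_lintegral_condDistrib [IsFiniteMeasure P] [StandardBorelSpace F] [Nonempty F]
    {X : Ω → E} {Y : Ω → F} (hX : Measurable X) (hY : Measurable Y) {f : F → ℝ≥0∞}
    (hf : Measurable f) {B : Set E} (hB : MeasurableSet B) :
    ∫⁻ x in B, ∫⁻ y, f y ∂(condDistrib Y X P x) ∂(P.map X) = ∫⁻ ω in X ⁻¹' B, f (Y ω) ∂P := by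
  calc ∫⁻ x in B, ∫⁻ y, f y ∂(condDistrib Y X P x) ∂(P.map X)
      = ∫⁻ z in B ×ˢ univ, f z.2 ∂(P.map X ⊗ₘ condDistrib Y X P) := by
        rw [Measure.setLIntegral_compProd (by fun_prop) hB .univ]
        simp only [Measure.restrict_univ]
    _ = ∫⁻ ω in X ⁻¹' B, f (Y ω) ∂P := by
        rw [compProd_map_condDistrib hY.aemeasurable,
          setLIntegral_map (hB.prod .univ) (by fun_prop) (hX.prodMk hY), mk_preimage_prod,
          preimage_univ, inter_univ]

lemma lintegral_nexp_mul_le_measure_lt_top {X : Ω → ℝ≥0∞} (hX : Measurable X) {s : ℝ≥0∞}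
    (hs : s ≠ 0) : ∫⁻ ω, nexp (s * X ω) ∂P ≤ P {ω | X ω < ∞} := by
  rw [← lintegral_indicator_one (measurableSet_lt hX measurable_const)]
  refine lintegral_mono fun ω => ?_
  by_cases hω : X ω < ∞
  · rw [indicator_of_mem (mem_ofPred_eq ▸ hω)]
    exact nexp_le_one _
  · rw [not_lt_top_iff.1 hω, ENNReal.mul_top hs, nexp_top]
    exact zero_le

end

namespace Params

variable (p : Params)

lemma linkLoss_injective (y : Plane) (b : Bool) : Function.Injective (p.linkLoss y b) := by
  intro x x' h
  simp only [linkLoss_eq] at h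
  split_ifs at h
  · exact mul_left_cancel₀ p.sigmaL_pos.ne' (by linarith [Real.exp_injective h])
  · exact mul_left_cancel₀ p.sigmaN_pos.ne' (by linarith [Real.exp_injective h])

lemma measurable_linkLoss_mark :
    Measurable fun w : Plane × Bool × ℝ × ℂ × (ℕ × ℝ) => p.linkLoss w.1 w.2.1 w.2.2.1 :=
  p.measurePreserving_lossMark.measurable.fst

lemma ae_linkLoss_ne (y : Plane) (c : ℝ) : ∀ᵐ k ∂p.markLaw, p.linkLoss y k.1 k.2.1 ≠ c := by
  have := nullSingletonClass_gaussianReal (μ := 0) (v := 1) one_ne_zero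
  have hshadow (b : Bool) : ∀ᵐ x ∂(gaussianReal 0 1), p.linkLoss y b x ≠ c := by
    have hsub : {x | p.linkLoss y b x = c}.Subsingleton := fun x hx x' hx' =>
      p.linkLoss_injective y b (hx.trans hx'.symm)
    simpa [ae_iff] using hsub.measure_zero (gaussianReal 0 1)
  have hmeas : MeasurableSet {k : Bool × ℝ × ℂ × (ℕ × ℝ) | p.linkLoss y k.1 k.2.1 ≠ c} :=
    (measurableSet_eq_fun (p.measurable_linkLoss_mark.comp measurable_prodMk_left)
      measurable_const).compl
  exact (Measure.ae_prod_iff_ae_ae hmeas).2 <| ae_of_all _ fun b =>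
    Measure.quasiMeasurePreserving_fst.ae (hshadow b)

lemma tendsto_laplaceAbove_lossInterferenceIntensity (hα : 2 < p.alphaN) {l : ℝ} (hl : 0 < l) :
    Tendsto (fun s => laplaceAbove (p.lossInterferenceIntensity s) l) (𝓝[>] 0) (𝓝 1) := by
  obtain ⟨C, hC, hle⟩ := p.exists_exponent_le hα hl
  have hs : Tendsto ENNReal.ofReal (𝓝[>] 0) (𝓝 0) := by
    simpa using (ENNReal.continuous_ofReal.tendsto 0).mono_left nhdsWithin_le_nhds
  have hbound : Tendsto (fun s => ENNReal.ofReal p.lamBS * (ENNReal.ofReal s * C)) (𝓝[>] 0)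
      (𝓝 0) := by
    simpa using ENNReal.Tendsto.const_mul (ENNReal.Tendsto.mul_const hs (Or.inr hC.ne))
      (Or.inr (ENNReal.ofReal_ne_top (r := p.lamBS)))
  have hexponent : Tendsto (fun s => ENNReal.ofReal p.lamBS * p.exponent s l) (𝓝[>] 0) (𝓝 0) :=
    tendsto_of_tendsto_of_tendsto_of_le_of_le' tendsto_const_nhds hbound
      (Eventually.of_forall fun s => zero_le)
      (eventually_mem_nhdsWithin.mono fun s hs => mul_le_mul_right (hle s (le_of_lt hs)) _)
  rw [← nexp_zero]
  exact ((continuous_nexp.tendsto 0).comp hexponent).congr' <| eventually_mem_nhdsWithin.mono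
    fun s hs => (p.laplaceAbove_lossInterferenceIntensity (le_of_lt hs) hl).symm

end Params

lemma measurable_toTuple : Measurable Mark.toTuple := comap_measurable _

namespace Network

variable {Ω : Type*} [MeasurableSpace Ω] {p : Params} {P : Measure Ω} (net : Network p P)

/-- Path loss of BS number `i`, and its interference multiplied by `s`. -/
def lossInterferenceOf (s : ℝ) (i : ℕ) (ω : Ω) : ℝ × ℝ≥0∞ :=
  p.lossInterference s (p.lossMark (net.pos i ω, (net.mark i ω).toTuple))

lemma lossInterferenceOf_fst (s : ℝ) (i : ℕ) (ω : Ω) :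
    (net.lossInterferenceOf s i ω).1 = net.lossOf i ω := by
  rw [lossOf, p.loss_eq_linkLoss]
  rfl

lemma lossInterferenceOf_snd (s : ℝ) (i : ℕ) (ω : Ω) :
    (net.lossInterferenceOf s i ω).2 = ENNReal.ofReal s * ENNReal.ofReal (p.G *
      ‖(net.mark i ω).fading‖ ^ 2 * (net.lossOf i ω)⁻¹ * (net.mark i ω).gain /
        (net.mark i ω).load) := by
  rw [lossOf, p.loss_eq_linkLoss]
  rfl

lemma measurable_tuple (i : ℕ) : Measurable fun ω => (net.mark i ω).toTuple :=
  measurable_toTuple.comp (net.measurable_mark i)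

lemma measurable_lossInterferenceOf (s : ℝ) (i : ℕ) : Measurable (net.lossInterferenceOf s i) :=
  (p.measurable_lossInterference s).comp <| p.measurePreserving_lossMark.measurable.comp <|
    (net.measurable_pos i).prodMk (net.measurable_tuple i)

lemma measurable_servingLoss : Measurable net.servingLoss := by
  have hlossOf (i : ℕ) : Measurable (net.lossOf i) := by
    simpa only [lossInterferenceOf_fst] using (net.measurable_lossInterferenceOf 0 i).fst
  have hjoint : Measurable fun z : ℕ × Ω => net.lossOf z.1 z.2 :=
    measurable_from_prod_countable_right hlossOf
  unfold servingLoss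
  simpa only [Function.comp_def, id] using
    hjoint.comp (net.measurable_serving.prodMk measurable_id)

lemma measurable_interference : Measurable net.interference := by
  refine Measurable.tsum fun i => Measurable.ite ?_ measurable_const ?_
  · exact measurableSet_eq_fun measurable_const net.measurable_serving
  · simpa only [lossInterferenceOf_snd, ENNReal.ofReal_one, one_mul] using
      (net.measurable_lossInterferenceOf 1 i).snd

lemma servingLoss_pos (ω : Ω) : 0 < net.servingLoss ω := by
  rw [servingLoss, lossOf, p.loss_eq_linkLoss]
  exact p.linkLoss_pos _ _ _

lemma ae_servingLoss_map_pos : ∀ᵐ l ∂(P.map net.servingLoss), 0 < l := by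
  rw [ae_map_iff net.measurable_servingLoss.aemeasurable measurableSet_Ioi]
  exact ae_of_all _ net.servingLoss_pos

variable [IsProbabilityMeasure P]

lemma hasPoissonLaplace (s : ℝ) :
    HasPoissonLaplace (net.lossInterferenceOf s) (p.lossInterferenceIntensity s) P := by
  have : SigmaFinite (ENNReal.ofReal p.lamBS • (volume : Measure Plane)) :=
    inferInstanceAs (SigmaFinite (p.lamBS.toNNReal • (volume : Measure Plane)))
  have hmarked : HasPoissonLaplace (fun i ω => (net.pos i ω, (net.mark i ω).toTuple))
      ((ENNReal.ofReal p.lamBS • volume).prod p.markLaw) P :=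
    (net.isPoisson.hasPoissonLaplace net.measurable_pos).prodMk net.measurable_pos
      net.measurable_tuple net.mark_law (net.mark_indep.comp _ fun _ => measurable_toTuple)
      (net.mark_indep_pos.comp (φ := fun k i => (k i).toTuple) (ψ := id)
        (measurable_pi_lambda _ fun i => measurable_toTuple.comp (measurable_pi_apply i))
        measurable_id)
  have hintensity : p.lossInterferenceIntensity s =
      (((ENNReal.ofReal p.lamBS • volume).prod p.markLaw).map p.lossMark).map
        (p.lossInterference s) := by
    rw [Measure.prod_smul_left, Measure.map_smul, p.measurePreserving_lossMark.map_eq,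
      Params.lossInterferenceIntensity]
  rw [hintensity]
  exact (hmarked.map p.measurePreserving_lossMark.measurable).map (p.measurable_lossInterference s)

lemma ae_lossOf_ne {i j : ℕ} (hij : i ≠ j) : ∀ᵐ ω ∂P, net.lossOf i ω ≠ net.lossOf j ω := by
  have hpair : Measurable fun ω => ((net.mark j ω).toTuple, (net.mark i ω).toTuple) :=
    (net.measurable_tuple j).prodMk (net.measurable_tuple i)
  have hpos : Measurable fun ω => (net.pos i ω, net.pos j ω) :=
    (net.measurable_pos i).prodMk (net.measurable_pos j)
  have hmarks : P.map (fun ω => ((net.mark j ω).toTuple, (net.mark i ω).toTuple)) =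
      p.markLaw.prod p.markLaw := by
    rw [(indepFun_iff_map_prod_eq_prod_map_map (net.measurable_tuple j).aemeasurable
      (net.measurable_tuple i).aemeasurable).1 ((net.mark_indep.indepFun hij.symm).comp
        measurable_toTuple measurable_toTuple), net.mark_law, net.mark_law]
  have hindep : IndepFun (fun ω => (net.pos i ω, net.pos j ω))
      (fun ω => ((net.mark j ω).toTuple, (net.mark i ω).toTuple)) P :=
    net.mark_indep_pos.symm.comp (φ := fun y => (y i, y j))
      (ψ := fun k => ((k j).toTuple, (k i).toTuple))
      ((measurable_pi_apply i).prodMk (measurable_pi_apply j))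
      ((measurable_toTuple.comp (measurable_pi_apply j)).prodMk
        (measurable_toTuple.comp (measurable_pi_apply i)))
  have hset : MeasurableSet {z : (Plane × Plane) × (Bool × ℝ × ℂ × (ℕ × ℝ)) ×
      (Bool × ℝ × ℂ × (ℕ × ℝ)) | p.linkLoss z.1.1 z.2.2.1 z.2.2.2.1 ≠
        p.linkLoss z.1.2 z.2.1.1 z.2.1.2.1} :=
    (measurableSet_eq_fun
      (p.measurable_linkLoss_mark.comp (measurable_fst.fst.prodMk measurable_snd.snd))
      (p.measurable_linkLoss_mark.comp (measurable_fst.snd.prodMk measurable_snd.fst))).compl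
  have hlaw := (Measure.ae_prod_iff_ae_ae (μ := P.map fun ω => (net.pos i ω, net.pos j ω))
    (ν := p.markLaw.prod p.markLaw) hset).2 <| ae_of_all _ fun y =>
      (Measure.ae_prod_iff_ae_ae (measurable_prodMk_left hset)).2 <| ae_of_all _ fun k =>
        p.ae_linkLoss_ne y.1 (p.linkLoss y.2 k.1 k.2.1)
  rw [← hmarks, ← (indepFun_iff_map_prod_eq_prod_map_map hpos.aemeasurable
    hpair.aemeasurable).1 hindep] at hlaw
  simp only [lossOf, p.loss_eq_linkLoss]
  exact ae_of_ae_map (hpos.prodMk hpair).aemeasurable hlaw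

lemma ae_servingLoss_lt :
    ∀ᵐ ω ∂P, ∀ i, i ≠ net.serving ω → net.servingLoss ω < net.lossOf i ω := by
  have hne : ∀ᵐ ω ∂P, ∀ i j, i ≠ j → net.lossOf i ω ≠ net.lossOf j ω := by
    simp only [ae_all_iff]
    exact fun i j => net.ae_lossOf_ne
  filter_upwards [hne, net.serving_min] with ω hne hmin i hi
  exact (hmin i).lt_of_ne (hne _ _ hi.symm)

lemma setLIntegral_nexp_interference (s : ℝ) {B : Set ℝ} (hB : MeasurableSet B) :
    ∫⁻ ω in net.servingLoss ⁻¹' B, nexp (ENNReal.ofReal s * net.interference ω) ∂P =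
      ∫⁻ l in B, laplaceAbove (p.lossInterferenceIntensity s) l ∂(P.map net.servingLoss) := by
  have hserving (ω : Ω) : (net.lossInterferenceOf s (net.serving ω) ω).1 = net.servingLoss ω :=
    net.lossInterferenceOf_fst s _ ω
  have h := (net.hasPoissonLaplace s).setLIntegral_nexp_tsum_ne_min (S := net.serving)
    (net.measurable_lossInterferenceOf s)
    (by simpa only [hserving] using net.measurable_servingLoss)
    (by simpa only [hserving, lossInterferenceOf_fst] using net.ae_servingLoss_lt) hB
  simp only [hserving, lossInterferenceOf_snd] at h
  simpa only [interference, ← ENNReal.tsum_mul_left, mul_ite, mul_zero] using h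

lemma ae_lintegral_condDistrib (s : ℝ) : ∀ᵐ l ∂(P.map net.servingLoss),
    ∫⁻ I, nexp (ENNReal.ofReal s * I) ∂(condDistrib net.interference net.servingLoss P l) =
      laplaceAbove (p.lossInterferenceIntensity s) l := by
  have hmeas : Measurable fun I : ℝ≥0∞ => nexp (ENNReal.ofReal s * I) := by fun_prop
  have : IsProbabilityMeasure (P.map net.servingLoss) :=
    Measure.isProbabilityMeasure_map net.measurable_servingLoss.aemeasurable
  refine ae_eq_of_forall_setLIntegral_eq_of_sigmaFinite hmeas.lintegral_kernel
    (measurable_laplaceAbove _) fun B hB _ => ?_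
  rw [setLIntegral_lintegral_condDistrib net.measurable_servingLoss net.measurable_interference
    hmeas hB, net.setLIntegral_nexp_interference s hB]

lemma condLaplace_eq (s l : ℝ) : net.condLaplace s l = (∫⁻ I, nexp (ENNReal.ofReal s * I)
    ∂(condDistrib net.interference net.servingLoss P l)).toReal := by
  have hmeas : Measurable fun I : ℝ≥0∞ => expNeg (ENNReal.ofReal s * I) := by
    simp only [← toReal_nexp]
    fun_prop
  rw [condLaplace, integral_eq_lintegral_of_nonneg_ae (ae_of_all _ fun I => expNeg_nonneg _)
    hmeas.aestronglyMeasurable]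
  simp only [ofReal_expNeg]

lemma ae_condLaplace_eq {s : ℝ} (hs : 0 ≤ s) : ∀ᵐ l ∂(P.map net.servingLoss),
    net.condLaplace s l = expNeg (ENNReal.ofReal p.lamBS * p.exponent s l) := by
  filter_upwards [net.ae_servingLoss_map_pos, net.ae_lintegral_condDistrib s] with l hl h
  rw [condLaplace_eq, h, p.laplaceAbove_lossInterferenceIntensity hs hl, toReal_nexp]

lemma ae_interference_lt_top (hα : 2 < p.alphaN) : ∀ᵐ ω ∂P, net.interference ω < ∞ := by
  have hmeas : MeasurableSet {ω | net.interference ω < ∞} :=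
    measurableSet_lt net.measurable_interference measurable_const
  have : IsProbabilityMeasure (P.map net.servingLoss) :=
    Measure.isProbabilityMeasure_map net.measurable_servingLoss.aemeasurable
  have hlim : Tendsto (fun s => ∫⁻ l, laplaceAbove (p.lossInterferenceIntensity s) l
      ∂(P.map net.servingLoss)) (𝓝[>] 0) (𝓝 1) := by
    have := tendsto_lintegral_filter_of_dominated_convergence (μ := P.map net.servingLoss)
      (l := 𝓝[>] (0 : ℝ)) (F := fun s => laplaceAbove (p.lossInterferenceIntensity s))
      (f := fun _ => 1) (fun _ => 1) (Eventually.of_forall fun s => measurable_laplaceAbove _)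
      (Eventually.of_forall fun s => ae_of_all _ fun l => nexp_le_one _) (by simp)
      (net.ae_servingLoss_map_pos.mono fun l hl =>
        p.tendsto_laplaceAbove_lossInterferenceIntensity hα hl)
    simpa using this
  have hle : ∀ᶠ s in 𝓝[>] (0 : ℝ), ∫⁻ l, laplaceAbove (p.lossInterferenceIntensity s) l
      ∂(P.map net.servingLoss) ≤ P {ω | net.interference ω < ∞} := by
    refine eventually_mem_nhdsWithin.mono fun s hs => ?_
    have h := net.setLIntegral_nexp_interference s MeasurableSet.univ
    rw [preimage_univ, Measure.restrict_univ, Measure.restrict_univ] at h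
    exact h ▸ lintegral_nexp_mul_le_measure_lt_top net.measurable_interference
      (ENNReal.ofReal_pos.2 hs).ne'
  exact (prob_compl_eq_zero_iff hmeas).2 (prob_le_one.antisymm (le_of_tendsto hlim hle))

end Network

end MmWave

end

theorem lemma6 {Ω : Type*} [MeasurableSpace Ω] (P : Measure Ω) [IsProbabilityMeasure P]
    (p : MmWave.Params) (net : MmWave.Network p P) (s : ℝ) (hs : 0 ≤ s) :
    -- `M` is differentiable and nondecreasing on `(0, ∞)`
    (∀ t : ℝ, 0 < t → DifferentiableAt ℝ p.M t ∧ 0 ≤ deriv p.M t) ∧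
    -- the conditional Laplace transform in closed form
    (∀ᵐ l ∂(P.map net.servingLoss),
      0 < l ∧ net.condLaplace s l = MmWave.expNeg (ENNReal.ofReal p.lamBS * p.exponent s l)) ∧
    -- all quantities are finite if the NLOS path loss exponent exceeds 2
    (2 < p.alphaN → (∀ᵐ ω ∂P, net.interference ω < ∞) ∧
      ∀ l : ℝ, 0 < l → p.exponent s l < ∞) := by
  refine ⟨fun t ht => ⟨p.differentiableAt_M ht, p.deriv_M_nonneg ht⟩,
    net.ae_servingLoss_map_pos.and (net.ae_condLaplace_eq hs),
    fun hα => ⟨net.ae_interference_lt_top hα, fun l hl => ?_⟩⟩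
  obtain ⟨C, hC, hle⟩ := p.exists_exponent_le hα hl
  exact (hle s hs).trans_lt (ENNReal.mul_lt_top ENNReal.ofReal_lt_top hC)
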